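/- Let $p \neq \ell$ be prime numbers, $k$ an algebraically closed field of characteristic $p$, $\overline{k((t))}$ a separable closure of $k((t))$, and $I=\mathrm{Gal}(\overline{k((t))}/k((t)))$ with its Krull topology. A $\overline{\mathbb Q}_\ell$-representation of $I$ means a finite-dimensional $\overline{\mathbb Q}_\ell$-vector space $V$ with a homomorphism $I\to\mathrm{GL}(V)$ that is continuous for the $\ell$-adic topology. It is called indecomposable if it is nonzero and is not the direct sum of two proper subrepresentations. For $N\ge 1$ let $\mu_N(k)=\{x\in k : x^N=1\}$, and fix $\zeta=(\zeta_N)\in\varprojlim_{(N,p)=1}\mu_N(k)$ (transition maps $x\mapsto x^{N/M}$ for $M\mid N$) with every $\zeta_N$ a primitive $N$-th root of unity. For $n\ge 1$ let $U(n)$ be the $n$-dimensional $\overline{\mathbb Q}_\ell$-representation of $I$ obtained by composing the canonical projection $I\to\varprojlim_{(N,p)=1}\mu_N(k)$, $\sigma\mapsto(\sigma(\sqrt[N]{t})/\sqrt[N]{t})_N$, with the continuous representation of $\varprojlim_{(N,p)=1}\mu_N(k)$ on $\overline{\mathbb Q}_\ell^{\,n}$ under which $\zeta$ acts by the single $n\times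 n$ unipotent Jordan block (ones on the diagonal and the superdiagonal, zeros elsewhere). (i) Let $V$ be an indecomposable $\overline{\mathbb Q}_\ell$-representation of $I$. Then there exist an irreducible $\overline{\mathbb Q}_\ell$-representation $W$ of $I$ and a positive integer $n$ such that $V\cong W\otimes U(n)$. This factorization is unique up to isomorphism: if also $V\cong W'\otimes U(n')$ with $W'$ an irreducible $\overline{\mathbb Q}_\ell$-representation of $I$ and $n'\ge 1$, then $n'=n$ and $W'\cong W$. Moreover, $W$ is isomorphic to every irreducible subrepresentation of $V$. (ii) Conversely, if $W$ is an irreducible $\overline{\mathbb Q}_\ell$-representation of $I$, then $W\otimes U(n)$ is indecomposable for every positive integer $n$. -/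

import Mathlib

open scoped LaurentSeries TensorProduct

universe u v

noncomputable section

namespace InertiaRep

/-! ### Representations of a topological group -/

section Reps

variable {G E V : Type*} [Group G] [Field E] [AddCommGroup V] [Module E V]

/-- A continuous finite-dimensional representation of a topological group `G` over a topological
field `E`. Continuity of `G → GL(V)` is expressed by continuity of all matrix coefficients
`g ↦ φ (ρ g v)`; see `isContinuousRep_iff` for the version with matrices. -/
structure IsContinuousRep [TopologicalSpace G] [TopologicalSpace E]
    (ρ : Representation E G V) : Prop where
  finite : Module.Finite E V
  continuous_coeff : ∀ (φ : Module.Dual E V) (v : V), Continuous fun g => φ (ρ g v)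

/-- A nonzero representation which is not the direct sum of two proper (equivalently, of two
nonzero) subrepresentations. -/
def IsIndecomposable (ρ : Representation E G V) : Prop :=
  Nontrivial V ∧ ∀ A B : Subrepresentation ρ,
    IsCompl A.toSubmodule B.toSubmodule → A.toSubmodule = ⊥ ∨ B.toSubmodule = ⊥

/-- Continuity means that in a basis (any basis) the matrix of `ρ g` is continuous in `g`. -/
theorem isContinuousRep_iff [TopologicalSpace G] [TopologicalSpace E]
    [IsTopologicalRing E] {ι : Type*} [Fintype ι] [DecidableEq ι] (b : Module.Basis ι E V)
    (ρ : Representation E G V) :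
    IsContinuousRep ρ ↔ Continuous fun g => LinearMap.toMatrix b b (ρ g) := by
  refine ⟨fun h => continuous_matrix fun i j => ?_,
    fun h => ⟨Module.Finite.of_basis b, fun φ v => ?_⟩⟩
  · simpa [LinearMap.toMatrix_apply] using h.2 (b.coord i) (b j)
  · have : (fun g => φ (ρ g v)) = fun g =>
        ∑ i, (LinearMap.toMatrix b b (ρ g)).mulVec (b.repr v) i * φ (b i) := by
      funext g
      rw [LinearMap.toMatrix_mulVec_repr]
      conv_lhs => rw [← b.sum_repr (ρ g v), map_sum]
      simp only [map_smul, smul_eq_mul]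
    rw [this]
    refine continuous_finsetSum _ fun i _ => Continuous.mul ?_ continuous_const
    exact (continuous_apply i).comp (h.matrix_mulVec continuous_const)

end Reps

/-! ### Powers of a unipotent Jordan block with `ℓ`-adic exponents -/

section Jordan

variable (ℓ : ℕ) [Fact ℓ.Prime]

/-- The inclusion of `ℤ_ℓ` in the algebraic closure of `ℚ_ℓ`. -/
def padicToAlgCl : ℤ_[ℓ] →+* PadicAlgCl ℓ :=
  (algebraMap ℚ_[ℓ] (PadicAlgCl ℓ)).comp PadicInt.Coe.ringHom

theorem continuous_padicToAlgCl : Continuous (padicToAlgCl ℓ) :=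
  (continuous_algebraMap ℚ_[ℓ] (PadicAlgCl ℓ)).comp continuous_subtype_val

/-- The `n × n` unipotent Jordan block: ones on the diagonal and just above it. -/
def jordanBlock (R : Type*) [Zero R] [One R] (n : ℕ) : Matrix (Fin n) (Fin n) R :=
  Matrix.of fun i j => if j.val = i.val ∨ j.val = i.val + 1 then 1 else 0

/-- The power `J ^ a` of the Jordan block `J = jordanBlock _ n` for `a : ℤ_ℓ`: the upper
triangular matrix with entries the binomial coefficients `a choose (j - i)`. It is the continuous
one-parameter group with value `J` at `1` (see the lemmas below). -/
def jordanPow (n : ℕ) (a : ℤ_[ℓ]) : Matrix (Fin n) (Fin n) (PadicAlgCl ℓ) :=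
  Matrix.of fun i j =>
    if i.val ≤ j.val then padicToAlgCl ℓ (Ring.choose a (j.val - i.val)) else 0

theorem jordanPow_zero (n : ℕ) : jordanPow ℓ n 0 = 1 := by
  ext i j
  rcases lt_trichotomy i.val j.val with h | h | h
  · have h2 : i ≠ j := fun e => by simp [e] at h
    simp [jordanPow, h2, Ring.choose_zero_pos ℤ_[ℓ] (show 0 < j.val - i.val by omega)]
  · have : i = j := Fin.ext h
    subst this
    simp [jordanPow]
  · have h2 : i ≠ j := fun e => by simp [e] at h
    have h3 : ¬ (i.val ≤ j.val) := by omega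
    simp only [jordanPow, Matrix.of_apply, if_neg h3, Matrix.one_apply_ne h2]

theorem jordanPow_one (n : ℕ) : jordanPow ℓ n 1 = jordanBlock (PadicAlgCl ℓ) n := by
  ext i j
  have key : ∀ m : ℕ, Ring.choose (1 : ℤ_[ℓ]) m = (Nat.choose 1 m : ℤ_[ℓ]) := fun m => by
    rw [← Ring.choose_natCast, Nat.cast_one]
  simp only [jordanPow, jordanBlock, Matrix.of_apply, key]
  rcases lt_trichotomy i.val j.val with h | h | h
  · rcases Nat.lt_or_ge (i.val + 1) j.val with h2 | h2
    · rw [Nat.choose_eq_zero_of_lt (by omega)]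
      simp [show ¬ (j.val = i.val ∨ j.val = i.val + 1) by omega]
    · rw [show j.val - i.val = 1 by omega]
      simp [show j.val = i.val + 1 by omega]
  · simp [h]
  · simp [show ¬ (i.val ≤ j.val) by omega, show ¬ (j.val = i.val ∨ j.val = i.val + 1) by omega]

theorem jordanPow_add (n : ℕ) (a b : ℤ_[ℓ]) :
    jordanPow ℓ n (a + b) = jordanPow ℓ n a * jordanPow ℓ n b := by
  ext i j
  simp only [jordanPow, Matrix.of_apply, Matrix.mul_apply]
  rw [Fin.sum_univ_eq_sum_range (fun k : ℕ =>
    (if i.val ≤ k then padicToAlgCl ℓ (Ring.choose a (k - i.val)) else 0) *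
      (if k ≤ j.val then padicToAlgCl ℓ (Ring.choose b (j.val - k)) else 0))]
  by_cases h : i.val ≤ j.val
  · rw [if_pos h, Ring.add_choose_eq _ (Commute.all a b),
      Finset.Nat.sum_antidiagonal_eq_sum_range_succ
        (fun x y => Ring.choose a x * Ring.choose b y), map_sum]
    simp only [map_mul]
    have : ∀ k : ℕ, ((if i.val ≤ k then padicToAlgCl ℓ (Ring.choose a (k - i.val)) else 0) *
        (if k ≤ j.val then padicToAlgCl ℓ (Ring.choose b (j.val - k)) else 0)) =
        if i.val ≤ k ∧ k ≤ j.val then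
          padicToAlgCl ℓ (Ring.choose a (k - i.val)) *
            padicToAlgCl ℓ (Ring.choose b (j.val - k)) else 0 := by
      intro k
      by_cases h1 : i.val ≤ k <;> by_cases h2 : k ≤ j.val <;> simp [h1, h2]
    rw [Finset.sum_congr rfl fun k _ => this k, ← Finset.sum_filter]
    symm
    have hj := j.isLt
    refine Finset.sum_bij' (fun k _ => k - i.val) (fun k _ => k + i.val) ?_ ?_ ?_ ?_ ?_
    · intro k hk
      simp only [Finset.mem_filter, Finset.mem_range] at hk ⊢
      omega
    · intro k hk
      simp only [Finset.mem_filter, Finset.mem_range] at hk ⊢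
      omega
    · intro k hk
      simp only [Finset.mem_filter, Finset.mem_range] at hk ⊢
      omega
    · intro k hk
      simp
    · intro k hk
      simp only [Finset.mem_filter, Finset.mem_range] at hk
      rw [show j.val - k = j.val - i.val - (k - i.val) by omega]
  · rw [if_neg h]
    symm
    refine Finset.sum_eq_zero fun k _ => ?_
    by_cases h1 : i.val ≤ k
    · rw [if_neg (fun h2 : k ≤ j.val => h (h1.trans h2)), mul_zero]
    · rw [if_neg h1, zero_mul]

theorem continuous_jordanPow (n : ℕ) : Continuous (jordanPow ℓ n) := by
  refine continuous_matrix fun i j => ?_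
  by_cases h : i.val ≤ j.val
  · simp only [jordanPow, Matrix.of_apply, if_pos h]
    exact (continuous_padicToAlgCl ℓ).comp (PadicInt.continuous_choose (p := ℓ) (j.val - i.val))
  · simp only [jordanPow, Matrix.of_apply, if_neg h]
    exact continuous_const

/-- `a ↦ J ^ a` as a representation of the additive group `ℤ_ℓ`. -/
def jordanRep (n : ℕ) :
    Representation (PadicAlgCl ℓ) (Multiplicative ℤ_[ℓ]) (Fin n → PadicAlgCl ℓ) where
  toFun a := Matrix.toLin' (jordanPow ℓ n a.toAdd)
  map_one' := by simp [jordanPow_zero, Module.End.one_eq_id]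
  map_mul' a b := by simp [jordanPow_add, Matrix.toLin'_mul, Module.End.mul_eq_comp]

end Jordan

/-! ### The tame quotient of the inertia group -/

section Tame

variable (p : ℕ) (k : Type*) [Field k]

/-- The inverse limit of the groups `μ_N(k)` of `N`-th roots of unity over all `N` prime to `p`,
with transition maps `μ_N → μ_M`, `x ↦ x ^ (N / M)` for `M ∣ N`. -/
def tameGroup : Subgroup ({N : ℕ // N.Coprime p} → kˣ) where
  carrier := {x | (∀ N, x N ^ N.1 = 1) ∧ ∀ M N, M.1 ∣ N.1 → x N ^ (N.1 / M.1) = x M}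
  one_mem' := by simp
  mul_mem' := by
    rintro x y ⟨hx, hx'⟩ ⟨hy, hy'⟩
    refine ⟨fun N => ?_, fun M N h => ?_⟩
    · rw [Pi.mul_apply, mul_pow, hx, hy, one_mul]
    · rw [Pi.mul_apply, mul_pow, hx' M N h, hy' M N h, Pi.mul_apply]
  inv_mem' := by
    rintro x ⟨hx, hx'⟩
    refine ⟨fun N => ?_, fun M N h => ?_⟩
    · rw [Pi.inv_apply, inv_pow, hx, inv_one]
    · rw [Pi.inv_apply, inv_pow, hx' M N h, Pi.inv_apply]

variable {p k}

/-- `ζ = (ζ_N)` is a compatible system of *primitive* roots of unity, i.e. a topological generator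
of the inverse limit. -/
def IsPrimitiveSystem (ζ : tameGroup p k) : Prop :=
  ∀ N, IsPrimitiveRoot (ζ.1 N) N.1

variable (k) in
/-- The uniformizer `t` of `k((t))`. -/
def uniformizer : k⸨X⸩ := HahnSeries.single 1 1

variable (k) in
/-- The embedding of the constants `k` in an extension `Ω` of `k((t))`. -/
def constants (Ω : Type*) [Field Ω] [Algebra k⸨X⸩ Ω] : k →+* Ω :=
  (algebraMap k⸨X⸩ Ω).comp HahnSeries.C

variable [Fact p.Prime] [CharP k p]

variable (k) in
theorem natCast_ne_zero_of_coprime {N : ℕ} (hN : N.Coprime p) : (N : k) ≠ 0 := by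
  intro h
  have h1 : p ∣ N := (CharP.cast_eq_zero_iff k p N).1 h
  have h2 : p ∣ 1 := hN ▸ Nat.dvd_gcd h1 dvd_rfl
  exact (Fact.out : p.Prime).one_lt.ne' (Nat.dvd_one.1 h2)

variable {Ω : Type*} [Field Ω] [Algebra k⸨X⸩ Ω]

theorem exists_root_uniformizer [IsSepClosure k⸨X⸩ Ω] {N : ℕ} (hN : N.Coprime p) :
    ∃ y : Ω, y ^ N = algebraMap k⸨X⸩ Ω (uniformizer k) := by
  have : IsSepClosed Ω := IsSepClosure.sep_closed k⸨X⸩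
  have : NeZero (N : Ω) := ⟨fun h => natCast_ne_zero_of_coprime k hN
    ((constants k Ω).injective (by rw [map_natCast, h, map_zero]))⟩
  exact IsSepClosed.exists_pow_nat_eq _ N

theorem algebraMap_uniformizer_ne_zero :
    algebraMap k⸨X⸩ Ω (uniformizer k) ≠ 0 := by
  rw [Ne, map_eq_zero, uniformizer]
  exact HahnSeries.single_ne_zero one_ne_zero

theorem root_ne_zero {N : ℕ} (hN : N.Coprime p) {y : Ω}
    (hy : y ^ N = algebraMap k⸨X⸩ Ω (uniformizer k)) : y ≠ 0 := by
  have hN0 : N ≠ 0 := fun h => natCast_ne_zero_of_coprime k hN (by simp [h])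
  intro h
  rw [h, zero_pow hN0] at hy
  exact algebraMap_uniformizer_ne_zero hy.symm

theorem galois_constants (σ : Gal(Ω/k⸨X⸩)) (c : k) : σ (constants k Ω c) = constants k Ω c :=
  σ.commutes _

theorem exists_unit_of_pow_eq_one [IsAlgClosed k] {N : ℕ} (hN : N.Coprime p) {r : Ω}
    (hr : r ^ N = 1) : ∃ c : kˣ, c ^ N = 1 ∧ constants k Ω c = r := by
  have : NeZero (N : k) := ⟨natCast_ne_zero_of_coprime k hN⟩
  have : NeZero N := NeZero.of_neZero_natCast k
  obtain ⟨z, hz⟩ := HasEnoughRootsOfUnity.exists_primitiveRoot k N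
  obtain ⟨i, -, hi⟩ := (hz.map_of_injective (constants k Ω).injective).eq_pow_of_pow_eq_one hr
  have hu : (hz.isUnit (NeZero.ne N)).unit ^ N = 1 := by
    ext
    simp [hz.pow_eq_one]
  refine ⟨(hz.isUnit (NeZero.ne N)).unit ^ i, ?_, ?_⟩
  · rw [← pow_mul, mul_comm, pow_mul, hu, one_pow]
  · simp [← hi]

theorem exists_kummer [IsAlgClosed k] [IsSepClosure k⸨X⸩ Ω] {N : ℕ} (hN : N.Coprime p)
    (σ : Gal(Ω/k⸨X⸩)) :
    ∃ c : kˣ, c ^ N = 1 ∧ ∀ y : Ω, y ^ N = algebraMap k⸨X⸩ Ω (uniformizer k) →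
      σ y = constants k Ω c * y := by
  obtain ⟨y, hy⟩ := exists_root_uniformizer (Ω := Ω) (k := k) hN
  have hy0 := root_ne_zero hN hy
  have hr : (σ y / y) ^ N = 1 := by
    rw [div_pow, ← map_pow, hy, AlgEquiv.commutes, div_self algebraMap_uniformizer_ne_zero]
  obtain ⟨c, hc, hcr⟩ := exists_unit_of_pow_eq_one (k := k) hN hr
  refine ⟨c, hc, fun z hz => ?_⟩
  have hzr : (z / y) ^ N = 1 := by
    rw [div_pow, hz, hy, div_self algebraMap_uniformizer_ne_zero]
  obtain ⟨d, -, hd⟩ := exists_unit_of_pow_eq_one (k := k) hN hzr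
  rw [eq_div_iff hy0] at hd hcr
  rw [← hd, map_mul, galois_constants, ← hcr]
  ring

variable [IsAlgClosed k] [IsSepClosure k⸨X⸩ Ω]

/-- The root of unity `σ(t^{1/N}) / t^{1/N} ∈ μ_N(k)`. It does not depend on the choice
of the `N`-th root `t^{1/N}` in `Ω`; see `kummer_spec`. -/
def kummer {N : ℕ} (hN : N.Coprime p) (σ : Gal(Ω/k⸨X⸩)) : kˣ :=
  (exists_kummer hN σ).choose

theorem kummer_pow {N : ℕ} (hN : N.Coprime p) (σ : Gal(Ω/k⸨X⸩)) : kummer hN σ ^ N = 1 :=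
  (exists_kummer hN σ).choose_spec.1

theorem kummer_spec {N : ℕ} (hN : N.Coprime p) (σ : Gal(Ω/k⸨X⸩)) {y : Ω}
    (hy : y ^ N = algebraMap k⸨X⸩ Ω (uniformizer k)) :
    σ y = constants k Ω (kummer hN σ) * y :=
  (exists_kummer hN σ).choose_spec.2 y hy

theorem kummer_eq {N : ℕ} (hN : N.Coprime p) (σ : Gal(Ω/k⸨X⸩)) {y : Ω}
    (hy : y ^ N = algebraMap k⸨X⸩ Ω (uniformizer k)) {c : kˣ}
    (h : σ y = constants k Ω c * y) : kummer hN σ = c := by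
  rw [kummer_spec hN σ hy] at h
  exact Units.ext ((constants k Ω).injective (mul_right_cancel₀ (root_ne_zero hN hy) h))

variable (p k Ω) in
/-- The canonical projection `I = Gal(Ω/k((t))) → lim μ_N(k)`, `σ ↦ (σ(t^{1/N}) / t^{1/N})_N`. Its
kernel is the wild inertia group. -/
def tameProjection : Gal(Ω/k⸨X⸩) →* tameGroup p k where
  toFun σ := ⟨fun N => kummer N.2 σ, fun N => kummer_pow N.2 σ, fun M N h => by
    obtain ⟨y, hy⟩ := exists_root_uniformizer (Ω := Ω) (k := k) N.2
    have hy' : (y ^ (N.1 / M.1)) ^ M.1 = algebraMap k⸨X⸩ Ω (uniformizer k) := by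
      rw [← pow_mul, Nat.div_mul_cancel h, hy]
    refine (kummer_eq M.2 σ hy' ?_).symm
    rw [map_pow, kummer_spec N.2 σ hy, mul_pow, Units.val_pow_eq_pow_val, map_pow]⟩
  map_one' := by
    refine Subtype.ext (funext fun N => ?_)
    obtain ⟨y, hy⟩ := exists_root_uniformizer (Ω := Ω) (k := k) N.2
    exact kummer_eq N.2 1 hy (by simp)
  map_mul' σ τ := by
    refine Subtype.ext (funext fun N => ?_)
    obtain ⟨y, hy⟩ := exists_root_uniformizer (Ω := Ω) (k := k) N.2
    refine kummer_eq N.2 (σ * τ) hy ?_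
    change σ (τ y) = constants k Ω ((kummer N.2 σ : k) * (kummer N.2 τ : k)) * y
    rw [kummer_spec N.2 τ hy, map_mul, galois_constants, kummer_spec N.2 σ hy, map_mul]
    ring

end Tame

/-! ### The representations `U(n)` -/

section Unipotent

variable {p ℓ : ℕ} [Fact p.Prime] [Fact ℓ.Prime] {k : Type*} [Field k]

theorem coprime_pow_of_ne (hℓ : ℓ ≠ p) (m : ℕ) : (ℓ ^ m).Coprime p :=
  Nat.Coprime.pow_left m ((Nat.coprime_primes Fact.out Fact.out).2 hℓ)

/-- The index `ℓ ^ m` of the inverse system, for `ℓ ≠ p`. -/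
def primePowIndex (hℓ : ℓ ≠ p) (m : ℕ) : {N : ℕ // N.Coprime p} :=
  ⟨ℓ ^ m, coprime_pow_of_ne hℓ m⟩

theorem pow_val_eq_iff {ζ : tameGroup p k} (hζ : IsPrimitiveSystem ζ) (hℓ : ℓ ≠ p) (m : ℕ)
    (a : ZMod (ℓ ^ m)) (i : ℕ) :
    ζ.1 (primePowIndex hℓ m) ^ i = ζ.1 (primePowIndex hℓ m) ^ a.val ↔ (i : ZMod (ℓ ^ m)) = a := by
  have h : orderOf (ζ.1 (primePowIndex hℓ m)) = ℓ ^ m := (hζ (primePowIndex hℓ m)).eq_orderOf.symm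
  rw [pow_eq_pow_iff_modEq, h, ← ZMod.natCast_eq_natCast_iff, ZMod.natCast_zmod_val]

theorem existsUnique_exponent {ζ : tameGroup p k} (hζ : IsPrimitiveSystem ζ) (hℓ : ℓ ≠ p)
    (x : tameGroup p k) :
    ∃! a : ℤ_[ℓ], ∀ m : ℕ, x.1 (primePowIndex hℓ m) =
      ζ.1 (primePowIndex hℓ m) ^ (PadicInt.toZModPow m a).val := by
  have hex : ∀ m : ℕ, ∃ i : ℕ, x.1 (primePowIndex hℓ m) = ζ.1 (primePowIndex hℓ m) ^ i := by
    intro m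
    have : NeZero (primePowIndex hℓ m).1 := ⟨pow_ne_zero m (Fact.out : ℓ.Prime).ne_zero⟩
    have h1 : (x.1 (primePowIndex hℓ m) : k) ^ (primePowIndex hℓ m).1 = 1 := by
      rw [← Units.val_pow_eq_pow_val, x.2.1, Units.val_one]
    obtain ⟨i, -, hi⟩ :=
      (IsPrimitiveRoot.coe_units_iff.2 (hζ (primePowIndex hℓ m))).eq_pow_of_pow_eq_one h1
    exact ⟨i, Units.ext (by rw [Units.val_pow_eq_pow_val, hi])⟩
  choose f hf using hex
  have hdvd : ∀ m, (ℓ : ℤ) ^ m ∣ (f (m + 1) : ℤ) - (f m : ℤ) := by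
    intro m
    have hd : (primePowIndex (p := p) hℓ m).1 ∣ (primePowIndex (p := p) hℓ (m + 1)).1 :=
      pow_dvd_pow ℓ m.le_succ
    have h1 := x.2.2 _ _ hd
    rw [hf, hf, ← pow_mul, mul_comm, pow_mul, ζ.2.2 _ _ hd] at h1
    have h := (pow_val_eq_iff hζ hℓ m (f m : ZMod (ℓ ^ m)) (f (m + 1))).1 (h1.trans
      ((pow_val_eq_iff hζ hℓ m (f m : ZMod (ℓ ^ m)) (f m)).2 rfl))
    rw [ZMod.natCast_eq_natCast_iff] at h
    have h3 := Nat.modEq_iff_dvd.1 h.symm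
    exact_mod_cast h3
  refine ⟨PadicInt.ofIntSeq _
    (PadicInt.isCauSeq_padicNorm_of_pow_dvd_sub (fun m => (f m : ℤ)) ℓ hdvd), ?_, ?_⟩
  · intro m
    rw [hf m, pow_val_eq_iff hζ,
      PadicInt.toZModPow_ofIntSeq_of_pow_dvd_sub (fun m => (f m : ℤ)) ℓ hdvd m]
    simp
  · intro b hb
    refine PadicInt.ext_of_toZModPow.1 fun m => ?_
    have h1 := hb m
    rw [hf m, pow_val_eq_iff hζ] at h1
    rw [PadicInt.toZModPow_ofIntSeq_of_pow_dvd_sub (fun m => (f m : ℤ)) ℓ hdvd m, ← h1]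
    simp

/-- The `ℓ`-part of `lim μ_N(k)` written through its generator `ζ`: the exponent `a` of `x` is
the `ℓ`-adic integer with `x_{ℓ^m} = ζ_{ℓ^m} ^ a` for all `m`. -/
def tameExponent {ζ : tameGroup p k} (hζ : IsPrimitiveSystem ζ) (hℓ : ℓ ≠ p) :
    tameGroup p k →* Multiplicative ℤ_[ℓ] where
  toFun x := Multiplicative.ofAdd (existsUnique_exponent hζ hℓ x).choose
  map_one' := by
    refine congrArg Multiplicative.ofAdd (Eq.symm
      ((existsUnique_exponent hζ hℓ 1).choose_spec.2 0 fun m => ?_))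
    simp
  map_mul' x y := by
    refine congrArg Multiplicative.ofAdd (Eq.symm ((existsUnique_exponent hζ hℓ (x * y)).choose_spec.2
      ((existsUnique_exponent hζ hℓ x).choose + (existsUnique_exponent hζ hℓ y).choose)
        fun m => ?_))
    have hx := (existsUnique_exponent hζ hℓ x).choose_spec.1 m
    have hy := (existsUnique_exponent hζ hℓ y).choose_spec.1 m
    rw [Subgroup.coe_mul, Pi.mul_apply, hx, hy, ← pow_add, pow_val_eq_iff hζ]
    simp

theorem tameExponent_spec {ζ : tameGroup p k} (hζ : IsPrimitiveSystem ζ) (hℓ : ℓ ≠ p)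
    (x : tameGroup p k) (m : ℕ) : x.1 (primePowIndex hℓ m) =
      ζ.1 (primePowIndex hℓ m) ^ (PadicInt.toZModPow m (tameExponent hζ hℓ x).toAdd).val :=
  (existsUnique_exponent hζ hℓ x).choose_spec.1 m

theorem tameExponent_self {ζ : tameGroup p k} (hζ : IsPrimitiveSystem ζ) (hℓ : ℓ ≠ p) :
    tameExponent hζ hℓ ζ = Multiplicative.ofAdd 1 := by
  refine congrArg Multiplicative.ofAdd (Eq.symm
    ((existsUnique_exponent hζ hℓ ζ).choose_spec.2 1 fun m => ?_))
  conv_lhs => rw [← pow_one (ζ.1 (primePowIndex hℓ m))]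
  rw [pow_val_eq_iff hζ]
  simp

/-- `U(n)` as a representation of `lim μ_N(k)`. -/
def tameU {ζ : tameGroup p k} (hζ : IsPrimitiveSystem ζ) (hℓ : ℓ ≠ p) (n : ℕ) :
    Representation (PadicAlgCl ℓ) (tameGroup p k) (Fin n → PadicAlgCl ℓ) :=
  (jordanRep ℓ n).comp (tameExponent hζ hℓ)

/-- On `U(n)` the generator `ζ` acts through the unipotent Jordan block of size `n`. -/
theorem tameU_self {ζ : tameGroup p k} (hζ : IsPrimitiveSystem ζ) (hℓ : ℓ ≠ p) (n : ℕ) :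
    tameU hζ hℓ n ζ = Matrix.toLin' (jordanBlock (PadicAlgCl ℓ) n) := by
  change jordanRep ℓ n (tameExponent hζ hℓ ζ) = _
  rw [tameExponent_self, ← jordanPow_one]
  rfl

variable [CharP k p] [IsAlgClosed k]

/-- `U(n)` as a representation of the inertia group `I = Gal(Ω/k((t)))`, through the canonical
projection of `I` to `lim μ_N(k)`. -/
def inertiaU (Ω : Type*) [Field Ω] [Algebra k⸨X⸩ Ω] [IsSepClosure k⸨X⸩ Ω]
    {ζ : tameGroup p k} (hζ : IsPrimitiveSystem ζ) (hℓ : ℓ ≠ p) (n : ℕ) :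
    Representation (PadicAlgCl ℓ) Gal(Ω/k⸨X⸩) (Fin n → PadicAlgCl ℓ) :=
  (tameU hζ hℓ n).comp (tameProjection p k Ω)

variable {Ω : Type*} [Field Ω] [Algebra k⸨X⸩ Ω] [IsSepClosure k⸨X⸩ Ω]

theorem isOpen_kummer_eq {N : ℕ} (hN : N.Coprime p) (σ : Gal(Ω/k⸨X⸩)) :
    IsOpen {τ : Gal(Ω/k⸨X⸩) | kummer hN τ = kummer hN σ} := by
  have : Algebra.IsSeparable k⸨X⸩ Ω := IsSepClosure.separable
  have : Algebra.IsIntegral k⸨X⸩ Ω := inferInstance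
  obtain ⟨y, hy⟩ := exists_root_uniformizer (Ω := Ω) (k := k) hN
  have h := (stabilizer_isOpen_of_isIntegral (K := k⸨X⸩) y).leftCoset σ
  convert h using 1
  ext τ
  rw [Set.mem_ofPred_eq, mem_leftCoset_iff, SetLike.mem_coe, MulAction.mem_stabilizer_iff]
  have e : (σ⁻¹ * τ) • y = y ↔ τ y = σ y := by
    rw [mul_smul, inv_smul_eq_iff]
    rfl
  rw [e]
  constructor
  · intro h
    rw [kummer_spec hN τ hy, kummer_spec hN σ hy, h]
  · intro h
    exact kummer_eq hN τ hy (by rw [h, kummer_spec hN σ hy])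

theorem continuous_tameExponent {ζ : tameGroup p k} (hζ : IsPrimitiveSystem ζ) (hℓ : ℓ ≠ p) :
    Continuous fun σ : Gal(Ω/k⸨X⸩) => (tameExponent hζ hℓ (tameProjection p k Ω σ)).toAdd := by
  rw [continuous_iff_continuousAt]
  intro σ
  rw [ContinuousAt, Metric.tendsto_nhds]
  intro ε hε
  obtain ⟨m, hm⟩ := PadicInt.exists_pow_neg_lt ℓ hε
  filter_upwards [(isOpen_kummer_eq (coprime_pow_of_ne hℓ m) σ).mem_nhds rfl] with τ hτ
  refine lt_of_le_of_lt ?_ hm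
  rw [dist_eq_norm, PadicInt.norm_le_pow_iff_mem_span_pow, ← PadicInt.ker_toZModPow,
    RingHom.mem_ker, map_sub, sub_eq_zero]
  have h1 := tameExponent_spec hζ hℓ (tameProjection p k Ω τ) m
  have h2 := tameExponent_spec hζ hℓ (tameProjection p k Ω σ) m
  have h3 : (tameProjection p k Ω τ).1 (primePowIndex hℓ m) =
      (tameProjection p k Ω σ).1 (primePowIndex hℓ m) := hτ
  rw [h1, h2, pow_val_eq_iff hζ, ZMod.natCast_zmod_val] at h3
  exact h3

/-- `U(n)` is a continuous representation of the inertia group. -/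
theorem isContinuousRep_inertiaU {ζ : tameGroup p k} (hζ : IsPrimitiveSystem ζ) (hℓ : ℓ ≠ p)
    (n : ℕ) : IsContinuousRep (inertiaU Ω hζ hℓ n) := by
  rw [isContinuousRep_iff (Pi.basisFun (PadicAlgCl ℓ) (Fin n))]
  have : (fun σ : Gal(Ω/k⸨X⸩) => LinearMap.toMatrix (Pi.basisFun (PadicAlgCl ℓ) (Fin n))
      (Pi.basisFun (PadicAlgCl ℓ) (Fin n)) (inertiaU Ω hζ hℓ n σ)) =
      fun σ => jordanPow ℓ n (tameExponent hζ hℓ (tameProjection p k Ω σ)).toAdd := by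
    funext σ
    change LinearMap.toMatrix' (Matrix.toLin' _) = _
    rw [LinearMap.toMatrix'_toLin']
  rw [this]
  exact (continuous_jordanPow ℓ n).comp (continuous_tameExponent hζ hℓ)

end Unipotent

end InertiaRep

end

noncomputable section

namespace InertiaRep

/-! ### Divisibility in extensions of `k((t))` -/

section AdicComplete

open scoped PowerSeries

/-! Let `χ : I → ℤ_ℓ` be the `ℓ`-part of the tame character (`inertiaExponent`); then U(n) is `g ↦ J
^ χ(g)`. The arithmetic input is that closed subgroups of `ker χ` have no continuous characters of
order `ℓ`. By Kummer theory (`eq_one_of_isClosed_ker`) it suffices that an extension of k((t))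
containing all `ℓ`-power roots of t is closed under `ℓ`-th roots. In a finite separable extension
units are `ℓ`-divisible by Hensel's lemma, so only the uniformizer matters, and the roots of t take
care of it (`exists_pow_eq_of_mem_intermediateField`). A compact group without such characters has
no nontrivial representation by matrices congruent to 1 (`eq_one_of_forall_norm_sub_one_lt`), so V
is trivial on `N ∩ ker χ` for some open normal N.

Take σ with χ(σ) = 1 and m = [I : N]. Then ρ(σ^m) commutes with ρ(I), and by indecomposability it is
a scalar times a unipotent (1 + x)^m, with x nilpotent and commuting with ρ. The twist θ(g) = ρ(g)(1
+ x)^(-χ(g)) is central on an open subgroup, hence semisimple by averaging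
(`IsIndecomposable.exists_twist`). If x has nilpotency class n and A is an irreducible
subrepresentation of the image of x^(n-1), lifting A equivariantly through x^(n-1) produces a copy
of A ⊗ U(n) with an invariant complement, which must vanish (`IsIndecomposable.exists_equiv_tprod`).

Uniqueness and the converse come from the socle of W ⊗ U(n). The last nonzero coordinate of an
equivariant map into it is equivariant, so Schur's lemma identifies the irreducible
subrepresentations with W; a trace argument in characteristic 0 shows that they all equal W ⊗ e₀
(`bijective_tensorCoord_zero`). Dimensions then recover n. -/

theorem isPrecomplete_of_finite {R M : Type*} [CommRing R] (I : Ideal R) [IsAdicComplete I R]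
    [AddCommGroup M] [Module R M] [Module.Finite R M] : IsPrecomplete I M := by
  rw [← AdicCompletion.of_surjective_iff]
  intro y
  obtain ⟨z, rfl⟩ := AdicCompletion.ofTensorProduct_surjective_of_finite I M y
  induction z using TensorProduct.induction_on with
  | zero => exact ⟨0, by simp⟩
  | add a b ha hb =>
    obtain ⟨x, hx⟩ := ha
    obtain ⟨y, hy⟩ := hb
    exact ⟨x + y, by rw [map_add, map_add, hx, hy]⟩
  | tmul r m =>
    obtain ⟨r, rfl⟩ := AdicCompletion.of_surjective I R r
    refine ⟨r • m, ?_⟩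
    rw [AdicCompletion.ofTensorProduct_tmul]
    ext n
    simp
    rfl

/-- Separatedness is Krull's intersection theorem for torsion-free modules. Both properties may be
checked for `B` as an `R`-module, where finiteness applies. -/
theorem isAdicComplete_map_of_finite {R B : Type*} [CommRing R] [IsDomain R] [IsNoetherianRing R]
    (I : Ideal R) (hI : I ≠ ⊤) [IsAdicComplete I R] [CommRing B] [Algebra R B] [Module.Finite R B]
    [Module.IsTorsionFree R B] : IsAdicComplete (I.map (algebraMap R B)) B := by
  have h1 : IsHausdorff (I.map (algebraMap R B)) B :=
    IsHausdorff.map_algebraMap_iff.2 (IsHausdorff.of_isTorsionFree I B hI)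
  have h2 : IsPrecomplete (I.map (algebraMap R B)) B :=
    IsPrecomplete.map_algebraMap_iff.2 (isPrecomplete_of_finite I)
  exact { }

/-- Idempotents lift along Henselian pairs, so a quotient of a domain has no nontrivial ones. -/
theorem eq_zero_or_one_of_isIdempotentElem {B : Type*} [CommRing B] [IsDomain B] (J : Ideal B)
    [HenselianRing B J] {e : B ⧸ J} (he : e * e = e) : e = 0 ∨ e = 1 := by
  obtain ⟨a, rfl⟩ := Ideal.Quotient.mk_surjective e
  obtain ⟨b, hb, hba⟩ := HenselianRing.is_henselian (I := J)
    (Polynomial.X ^ 2 - Polynomial.X : Polynomial B) (by monicity!) a (by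
      simp only [Polynomial.eval_sub, Polynomial.eval_pow, Polynomial.eval_X]
      rw [← Ideal.Quotient.eq_zero_iff_mem, map_sub, map_pow, pow_two, he, sub_self]) (by
      -- The derivative `2e - 1` is its own inverse: `(2e - 1)² = 4(e² - e) + 1 = 1`.
      refine IsUnit.of_mul_eq_one (Ideal.Quotient.mk J (2 * a - 1)) ?_
      simp only [Polynomial.derivative_X_sq, Polynomial.derivative_X,
        Polynomial.eval_sub, Polynomial.eval_mul, Polynomial.eval_ofNat, Polynomial.eval_X,
        Polynomial.eval_one, map_sub, map_mul, map_one, map_ofNat]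
      linear_combination 4 * he)
  rw [Polynomial.IsRoot.def] at hb
  have hb' : b * (b - 1) = 0 := by
    simp at hb
    linear_combination hb
  rw [← Ideal.Quotient.eq] at hba
  rcases mul_eq_zero.1 hb' with h | h
  · left; rw [← hba, h, map_zero]
  · right; rw [← hba, sub_eq_zero.1 h, map_one]

/-- In an Artinian ring without nontrivial idempotents, nonunits are nilpotent. -/
theorem isUnit_or_isNilpotent_of_isArtinianRing {R : Type*} [CommRing R] [IsArtinianRing R]
    (hR : ∀ e : R, e * e = e → e = 0 ∨ e = 1) (a : R) : IsUnit a ∨ IsNilpotent a := by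
  obtain ⟨n, y, hn⟩ := IsArtinian.exists_pow_succ_smul_dvd a (1 : R)
  simp only [smul_eq_mul, mul_one] at hn
  have h1 : ∀ i, a ^ (n + i) * y ^ i = a ^ n := by
    intro i
    induction i with
    | zero => simp
    | succ i ih =>
      calc a ^ (n + (i + 1)) * y ^ (i + 1) = a ^ i * y ^ i * (a ^ n.succ * y) := by
            rw [Nat.succ_eq_add_one]; ring
        _ = a ^ n := by rw [hn]; linear_combination ih
  have h2 := h1 n
  rcases hR (a ^ n * y ^ n) (by linear_combination y ^ n * h2) with h | h
  · refine Or.inr ⟨n, ?_⟩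
    rw [← h2]
    linear_combination a ^ n * h
  · rcases Nat.eq_zero_or_pos n with rfl | hn0
    · simp only [Nat.succ_eq_add_one, zero_add, pow_one, pow_zero] at hn
      exact Or.inl (IsUnit.of_mul_eq_one _ hn)
    · exact Or.inl ((isUnit_pow_iff hn0.ne').1 (IsUnit.of_mul_eq_one _ h))

variable {k : Type*} [Field k] [IsAlgClosed k]

/-- A finite algebra over an algebraically closed field whose nonunits are nilpotent has
`n`-th roots of units, for `n` invertible. -/
theorem exists_pow_eq_of_isUnit_of_finite {R : Type*} [CommRing R] [Algebra k R]
    [Module.Finite k R] (hR : ∀ a : R, IsUnit a ∨ IsNilpotent a) {n : ℕ} (hn : (n : k) ≠ 0)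
    {u : R} (hu : IsUnit u) : ∃ v : R, v ^ n = u := by
  rcases subsingleton_or_nontrivial R with h | h
  · exact ⟨0, Subsingleton.elim _ _⟩
  have hn0 : n ≠ 0 := fun h => hn (by simp [h])
  -- For `c` in the spectrum, `c - u` is a nonunit, hence nilpotent. An `n`-th root `d` of `c` is
  -- thus a root of `X ^ n - u` up to a nilpotent, and Newton iteration corrects it because `n * d ^
  -- (n - 1)` is invertible.
  obtain ⟨c, hc⟩ := spectrum.nonempty_of_isAlgClosed_of_finiteDimensional k u
  have hc' : IsNilpotent (algebraMap k R c - u) := (hR _).resolve_left hc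
  have hc0 : c ≠ 0 := by
    rintro rfl
    rw [map_zero, zero_sub, isNilpotent_neg_iff] at hc'
    exact hc'.not_isUnit hu
  obtain ⟨d, hd⟩ := IsAlgClosed.exists_pow_nat_eq c (Nat.pos_of_ne_zero hn0)
  have hd0 : d ≠ 0 := by
    rintro rfl
    exact hc0 (by rw [← hd, zero_pow hn0])
  obtain ⟨r, ⟨-, hr⟩, -⟩ := Polynomial.existsUnique_nilpotent_sub_and_aeval_eq_zero
    (P := (Polynomial.X ^ n - Polynomial.C u : Polynomial R)) (x := algebraMap k R d)
    (by simpa [← map_pow, hd] using hc')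
    (by
      have : (n : k) * d ^ (n - 1) ≠ 0 := mul_ne_zero hn (pow_ne_zero _ hd0)
      simpa [Polynomial.derivative_X_pow] using (IsUnit.mk0 _ this).map (algebraMap k R))
  exact ⟨r, by simpa [sub_eq_zero] using hr⟩

/-- A root modulo `J` exists in the finite `k`-algebra `B ⧸ J`; it is simple, since `n` and the root
are units there, so it lifts. -/
theorem exists_pow_eq_of_isUnit_of_henselian {B : Type*} [CommRing B] (J : Ideal B)
    [HenselianRing B J] [Algebra k B] [Module.Finite k (B ⧸ J)]
    (hB : ∀ a : B ⧸ J, IsUnit a ∨ IsNilpotent a) {n : ℕ} (hn : (n : k) ≠ 0) {u : B}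
    (hu : IsUnit u) : ∃ v : B, v ^ n = u := by
  have hn0 : n ≠ 0 := fun h => hn (by simp [h])
  obtain ⟨a, ha⟩ := exists_pow_eq_of_isUnit_of_finite hB hn (hu.map (Ideal.Quotient.mk J))
  obtain ⟨a, rfl⟩ := Ideal.Quotient.mk_surjective a
  obtain ⟨v, hv, -⟩ := HenselianRing.is_henselian (I := J)
    (Polynomial.X ^ n - Polynomial.C u : Polynomial B) (Polynomial.monic_X_pow_sub_C u hn0) a
    (by rw [← Ideal.Quotient.eq_zero_iff_mem]; simp [ha]) (by
      have h1 : IsUnit (Ideal.Quotient.mk J a) := by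
        rw [← isUnit_pow_iff hn0, ha]
        exact hu.map _
      have h2 : IsUnit ((n : B ⧸ J)) := by
        simpa using (IsUnit.mk0 _ hn).map (algebraMap k (B ⧸ J))
      simpa [Polynomial.derivative_X_pow] using h2.mul (h1.pow (n - 1)))
  exact ⟨v, by simpa [sub_eq_zero] using hv⟩

/-! ### Finite torsion-free domains over `k⟦X⟧` -/

section FinitePowerSeries

open scoped PowerSeries

variable {B : Type*} [CommRing B] [IsDomain B] [Algebra k⟦X⟧ B] [Module.Finite k⟦X⟧ B]
  [Module.IsTorsionFree k⟦X⟧ B]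

/-- `B` is `X`-adically complete, so idempotents of `B ⧸ J` lift to the domain `B` and are trivial.
Being finite over `k`, `B ⧸ J` is Artinian, so its nonunits are nilpotent. Since `J` lies in the
Jacobson radical, locality passes to `B`; Hensel's lemma lifts roots of units. -/
theorem isLocalRing_of_finite_powerSeries :
    IsLocalRing B ∧ ¬ IsUnit (algebraMap k⟦X⟧ B PowerSeries.X) ∧
      ∀ n : ℕ, (n : k) ≠ 0 → ∀ u : B, IsUnit u → ∃ v, v ^ n = u := by
  let I : Ideal k⟦X⟧ := Ideal.span {PowerSeries.X}
  have hI : I ≠ ⊤ := by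
    rw [Ne, Ideal.span_singleton_eq_top]
    exact PowerSeries.X_prime.not_isUnit
  let J : Ideal B := I.map (algebraMap k⟦X⟧ B)
  have : IsAdicComplete J B := isAdicComplete_map_of_finite I hI
  let _ : Algebra k B := ((algebraMap k⟦X⟧ B).comp (algebraMap k k⟦X⟧)).toAlgebra
  have : IsScalarTower k k⟦X⟧ B := IsScalarTower.of_algebraMap_eq fun _ => rfl
  have : Module.Finite k (B ⧸ J) := by
    obtain ⟨s, hs⟩ := (inferInstance : Module.Finite k⟦X⟧ (B ⧸ J))
    refine ⟨s, eq_top_iff.2 fun x _ => ?_⟩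
    have hx : x ∈ Submodule.span k⟦X⟧ (s : Set (B ⧸ J)) := hs ▸ Submodule.mem_top
    induction hx using Submodule.span_induction with
    | mem x h => exact Submodule.subset_span h
    | zero => exact zero_mem _
    | add x y _ _ hx hy => exact add_mem (hx trivial) (hy trivial)
    | smul f x _ hx =>
      -- Power series act on `B ⧸ J` through their constant term, so generators over `k⟦X⟧` already
      -- span over `k`.
      have : f • x = PowerSeries.constantCoeff f • x := by
        rw [← algebraMap_smul k⟦X⟧ (PowerSeries.constantCoeff f) x, ← sub_eq_zero, ← sub_smul]
        have h : f - algebraMap k k⟦X⟧ (PowerSeries.constantCoeff f) ∈ I := by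
          rw [Ideal.mem_span_singleton, PowerSeries.X_dvd_iff]
          simp
        obtain ⟨b, rfl⟩ := Ideal.Quotient.mk_surjective x
        rw [← Ideal.Quotient.mkₐ_eq_mk k⟦X⟧ J, ← map_smul, Ideal.Quotient.mkₐ_eq_mk,
          Ideal.Quotient.eq_zero_iff_mem, Algebra.smul_def]
        exact J.mul_mem_right _ (Ideal.mem_map_of_mem _ h)
      rw [this]
      exact Submodule.smul_mem _ _ (hx trivial)
  have : IsArtinianRing (B ⧸ J) := IsArtinianRing.of_finite k _
  have hJ : ∀ a : B ⧸ J, IsUnit a ∨ IsNilpotent a :=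
    isUnit_or_isNilpotent_of_isArtinianRing fun e => eq_zero_or_one_of_isIdempotentElem J
  have hJ' : J ≤ Ideal.jacobson ⊥ := IsAdicComplete.le_jacobson_bot J
  have hlh : IsLocalHom (Ideal.Quotient.mk J) := isLocalHom_of_le_jacobson_bot J hJ'
  have hloc : IsLocalRing B := IsLocalRing.of_isUnit_or_isUnit_one_sub_self fun a => by
    rcases hJ (Ideal.Quotient.mk J a) with h | h
    · exact Or.inl (hlh.map_nonunit a h)
    · exact Or.inr (hlh.map_nonunit _ (by simpa using h.isUnit_one_sub))
  have hXJ : algebraMap k⟦X⟧ B PowerSeries.X ∈ J :=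
    Ideal.mem_map_of_mem _ (Ideal.mem_span_singleton_self _)
  refine ⟨hloc, ?_, fun n hn u hu => exists_pow_eq_of_isUnit_of_henselian J hJ hn hu⟩
  rw [← mem_nonunits_iff, ← IsLocalRing.mem_maximalIdeal,
    ← IsLocalRing.jacobson_eq_maximalIdeal (⊥ : Ideal B) bot_ne_top]
  exact hJ' hXJ

end FinitePowerSeries

/-! ### Finite separable extensions of `k((t))` -/

variable {L : Type*} [Field L] [Algebra k⸨X⸩ L] [FiniteDimensional k⸨X⸩ L]
  [Algebra.IsSeparable k⸨X⸩ L]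

open scoped PowerSeries in
/-- The structure of the multiplicative group of a finite separable extension of `k((t))`. -/
theorem exists_uniformizer_of_finite :
    ∃ (U : Subgroup Lˣ) (π : Lˣ) (e : ℕ) (w : Lˣ), e ≠ 0 ∧ w ∈ U ∧
      algebraMap k⸨X⸩ L (uniformizer k) = π ^ e * w ∧
      (∀ n : ℕ, (n : k) ≠ 0 → ∀ u ∈ U, ∃ v ∈ U, v ^ n = u) ∧
      ∀ x : Lˣ, ∃ (n : ℤ), ∃ u ∈ U, x = π ^ n * u := by
  let : Algebra k⟦X⟧ L := ((algebraMap k⸨X⸩ L).comp (algebraMap k⟦X⟧ k⸨X⸩)).toAlgebra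
  have : IsScalarTower k⟦X⟧ k⸨X⸩ L := IsScalarTower.of_algebraMap_eq fun _ => rfl
  let B := integralClosure k⟦X⟧ L
  have : Module.IsTorsionFree k⟦X⟧ L := Module.IsTorsionFree.trans_faithfulSMul k⟦X⟧ k⸨X⸩ L
  have : Module.Finite k⟦X⟧ B := IsIntegralClosure.finite k⟦X⟧ k⸨X⸩ L B
  have : IsDedekindDomain B := IsIntegralClosure.isDedekindDomain k⟦X⟧ k⸨X⸩ L B
  have : IsFractionRing B L := IsIntegralClosure.isFractionRing_of_finite_extension k⟦X⟧ k⸨X⸩ L B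
  obtain ⟨_, hX, hroot⟩ := isLocalRing_of_finite_powerSeries (k := k) (B := B)
  have hBf : ¬ IsField B := fun h => by
    have : Algebra.IsIntegral k⟦X⟧ B := IsIntegralClosure.isIntegral_algebra k⟦X⟧ L
    exact PowerSeries.not_isField (isField_of_isIntegral_of_isField
      (FaithfulSMul.algebraMap_injective k⟦X⟧ B) h)
  have : IsDiscreteValuationRing B :=
    ((IsDiscreteValuationRing.TFAE B hBf).out 0 2).2 ‹IsDedekindDomain B›
  obtain ⟨ϖ, hϖ⟩ := IsDiscreteValuationRing.exists_irreducible B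
  have hX0 : algebraMap k⟦X⟧ B PowerSeries.X ≠ 0 := by
    rw [Ne, FaithfulSMul.algebraMap_eq_zero_iff]
    exact PowerSeries.X_ne_zero
  obtain ⟨e, w, hw⟩ := IsDiscreteValuationRing.eq_unit_mul_pow_irreducible hX0 hϖ
  have hϖ0 : algebraMap B L ϖ ≠ 0 := by
    rw [Ne, FaithfulSMul.algebraMap_eq_zero_iff]
    exact hϖ.ne_zero
  -- `U` is the unit group of the discrete valuation ring `B`, and `e` is the ramification index,
  -- nonzero because `X` is not a unit of `B`.
  refine ⟨(Units.map (algebraMap B L : B →* L)).range, Units.mk0 _ hϖ0, e,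
    Units.map (algebraMap B L : B →* L) w, ?_, ⟨w, rfl⟩, ?_, ?_, ?_⟩
  · rintro rfl
    exact hX (by simp [hw])
  · have h1 : uniformizer k = algebraMap k⟦X⟧ k⸨X⸩ PowerSeries.X :=
      (HahnSeries.ofPowerSeries_X).symm
    rw [h1, ← IsScalarTower.algebraMap_apply k⟦X⟧ k⸨X⸩ L,
      IsScalarTower.algebraMap_apply k⟦X⟧ B L, hw]
    simp [mul_comm]
  · rintro n hn _ ⟨u, rfl⟩
    obtain ⟨v, hv⟩ := hroot n hn u u.isUnit
    have hn0 : n ≠ 0 := fun h => hn (by simp [h])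
    have hv' : IsUnit v := by
      rw [← isUnit_pow_iff hn0, hv]
      exact u.isUnit
    refine ⟨_, ⟨hv'.unit, rfl⟩, ?_⟩
    rw [← map_pow]
    congr 1
    ext
    simp [hv]
  · intro x
    obtain ⟨n, u, hu⟩ := IsDiscreteValuationRing.exists_units_eq_smul_zpow_of_irreducible
      (R := B) hϖ x.ne_zero
    refine ⟨n, _, ⟨u, rfl⟩, Units.ext ?_⟩
    rw [hu]
    simp [Units.smul_def, Algebra.smul_def, mul_comm]

/-- An extension of `k((t))` inside a separable closure that contains all the `ℓ`-power roots of
`t` is closed under `ℓ`-th roots. -/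
theorem exists_pow_eq_of_mem_intermediateField {Ω : Type*} [Field Ω] [Algebra k⸨X⸩ Ω]
    [IsSepClosure k⸨X⸩ Ω] {ℓ : ℕ} (hℓ : ℓ.Prime) (hk : (ℓ : k) ≠ 0)
    (F : IntermediateField k⸨X⸩ Ω)
    (hF : ∀ (m : ℕ) (y : Ω), y ^ ℓ ^ m = algebraMap k⸨X⸩ Ω (uniformizer k) → y ∈ F)
    {x : Ω} (hx : x ∈ F) : ∃ w ∈ F, w ^ ℓ = x := by
  rcases eq_or_ne x 0 with rfl | hx0
  · exact ⟨0, zero_mem _, zero_pow hℓ.ne_zero⟩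
  have : Algebra.IsSeparable k⸨X⸩ Ω := IsSepClosure.separable
  have : IsSepClosed Ω := IsSepClosure.sep_closed k⸨X⸩
  have : NeZero (ℓ : Ω) := ⟨fun h => hk ((constants k Ω).injective (by
    rw [map_natCast, h, map_zero]))⟩
  let L := IntermediateField.adjoin k⸨X⸩ {x}
  have : FiniteDimensional k⸨X⸩ L :=
    IntermediateField.adjoin.finiteDimensional (Algebra.IsIntegral.isIntegral x)
  have hLF : ∀ y : L, (y : Ω) ∈ F := fun y =>
    (IntermediateField.adjoin_le_iff.2 (Set.singleton_subset_iff.2 hx) : L ≤ F) y.2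
  obtain ⟨U, π, e, w, he, hw, ht, hU, hπ⟩ := exists_uniformizer_of_finite (k := k) (L := L)
  -- With `e = ℓ ^ b * e'` and `w = v ^ ℓ ^ b`, the uniformizer `t` is the `ℓ ^ b`-th power of `π ^
  -- e' * v`. An `ℓ`-th root `z` of the latter is an `ℓ ^ (b + 1)`-th root of `t`, hence in `F`.
  obtain ⟨b, e', he', rfl⟩ := Nat.exists_eq_pow_mul_and_not_dvd he ℓ hℓ.ne_one
  obtain ⟨v, hv, hvw⟩ := hU (ℓ ^ b) (by rw [Nat.cast_pow]; exact pow_ne_zero _ hk) w hw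
  obtain ⟨v₁, -, hv₁⟩ := hU ℓ hk v hv
  let xL : Lˣ := Units.mk0 ⟨x, IntermediateField.mem_adjoin_simple_self _ x⟩
    (fun h => hx0 (congrArg Subtype.val h))
  obtain ⟨n, u, hu, hxu⟩ := hπ xL
  obtain ⟨u₁, -, hu₁⟩ := hU ℓ hk u hu
  let ι : L →+* Ω := algebraMap L Ω
  obtain ⟨z, hz⟩ := IsSepClosed.exists_pow_nat_eq (ι (π ^ e' * v : Lˣ)) ℓ
  have hzF : z ∈ F := by
    refine hF (b + 1) z ?_
    rw [pow_succ', pow_mul, hz, ← map_pow, IsScalarTower.algebraMap_apply k⸨X⸩ L Ω, ht, ← hvw]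
    congr 1
    push_cast
    ring
  have hz0 : z ≠ 0 := by
    rintro rfl
    rw [zero_pow hℓ.ne_zero] at hz
    exact (π ^ e' * v).ne_zero ((map_eq_zero ι).1 hz.symm)
  let φ : Lˣ →* Ωˣ := Units.map (ι : L →* Ω)
  let Z : Ωˣ := Units.mk0 z hz0
  have hZ : Z ^ ℓ = φ π ^ e' * φ v₁ ^ ℓ := by
    rw [← map_pow, ← map_pow, ← map_mul, hv₁]
    exact Units.ext hz
  -- As `ℓ ∤ e'`, Bézout turns an `ℓ`-th root of `π ^ e'` into one of `π`, and then of `x = π ^ n *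
  -- u`.
  have hcop : IsCoprime (e' : ℤ) ℓ :=
    Nat.isCoprime_iff_coprime.2 ((Nat.Prime.coprime_iff_not_dvd hℓ).2 he').symm
  obtain ⟨a, c, hac⟩ := hcop
  have h1 : (Z / φ v₁) ^ ℓ = φ π ^ e' := by rw [div_pow, hZ, mul_div_cancel_right]
  have h2 : ((Z / φ v₁) ^ a * φ π ^ c) ^ ℓ = φ π := by
    calc ((Z / φ v₁) ^ a * φ π ^ c) ^ ℓ = ((Z / φ v₁) ^ ℓ) ^ a * φ π ^ (c * ℓ) := by
          rw [mul_pow, ← zpow_natCast, ← zpow_natCast, ← zpow_natCast, ← zpow_mul, ← zpow_mul,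
            ← zpow_mul, mul_comm a]
      _ = φ π := by
          rw [h1, ← zpow_natCast, ← zpow_mul, ← zpow_add, mul_comm (e' : ℤ), hac, zpow_one]
  have h3 : ∀ s : Ωˣ, s ^ ℓ = φ π → (s ^ n * φ u₁) ^ ℓ = φ xL := fun s hs => by
    rw [mul_pow, ← map_pow φ u₁, hu₁, hxu, map_mul, map_zpow, ← hs, ← zpow_natCast, ← zpow_natCast,
      ← zpow_mul, ← zpow_mul, mul_comm n]
  refine ⟨_, ?_, (congrArg Units.val (h3 _ h2) : _)⟩
  have hφ : ∀ y : Lˣ, (φ y : Ω) ∈ F := fun y => hLF y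
  simp only [Units.val_mul, Units.val_zpow_eq_zpow_val, Units.val_div_eq_div_val]
  exact mul_mem (zpow_mem (mul_mem (zpow_mem (div_mem hzF (hφ _)) _) (zpow_mem (hφ _) _)) _) (hφ _)

end AdicComplete

/-! ### Kummer theory over an `ℓ`-divisible field -/

section Kummer

variable {K Ω : Type*} [Field K] [Field Ω] [Algebra K Ω] [IsGalois K Ω]

/-- If the fixed field of `H` is closed under `ℓ`-th roots and contains the `ℓ`-th roots of unity,
then `H` has no continuous characters of order `ℓ`. -/
theorem eq_one_of_isClosed_ker {ℓ : ℕ} [Fact ℓ.Prime] {ξ : K} (hξ : IsPrimitiveRoot ξ ℓ)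
    (H : Subgroup Gal(Ω/K))
    (hroot : ∀ x ∈ IntermediateField.fixedField H, ∃ w ∈ IntermediateField.fixedField H, w ^ ℓ = x)
    (f : H →* Multiplicative (ZMod ℓ))
    (hf : IsClosed ((f.ker.map H.subtype : Subgroup Gal(Ω/K)) : Set Gal(Ω/K))) (h : H) :
    f h = 1 := by
  by_contra hh
  have hℓ : ℓ.Prime := Fact.out
  let a : ZMod ℓ := (f h).toAdd
  have ha : a ≠ 0 := hh
  -- The exponent normalizes `f g` to the class of 1.
  let g : H := h ^ (a⁻¹).val
  have hg : ∀ i : ℕ, f (g ^ i) = Multiplicative.ofAdd (i : ZMod ℓ) := by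
    intro i
    have : f g = Multiplicative.ofAdd 1 := by
      refine Multiplicative.toAdd.injective ?_
      change Multiplicative.toAdd (f (h ^ (a⁻¹).val)) = 1
      rw [map_pow, toAdd_pow, nsmul_eq_mul, ZMod.natCast_zmod_val]
      exact inv_mul_cancel₀ ha
    rw [map_pow, this, ← ofAdd_nsmul, nsmul_one]
  let N : Subgroup Gal(Ω/K) := f.ker.map H.subtype
  have hN : ∀ n : H, f n = 1 → (n : Gal(Ω/K)) ∈ N := fun n hn => ⟨n, hn, rfl⟩
  let M := IntermediateField.fixedField N
  have hM : ∀ y : M, ∀ n : H, f n = 1 → (n : Gal(Ω/K)) y = y := fun y n hn => y.2 ⟨_, hN n hn⟩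
  let χ : Fin ℓ → M →* Ω := fun i =>
    (((g ^ (i : ℕ) : H) : Gal(Ω/K)) : Ω →* Ω).comp (algebraMap M Ω : M →* Ω)
  -- Closedness of `N` enters here: by the Galois correspondence only elements of `N` fix `M`, so
  -- the powers of `g` are distinct on `M`, and Dedekind independence applies.
  have hχ : Function.Injective χ := by
    intro i j hij
    have h1 : (((g ^ (j : ℕ))⁻¹ * g ^ (i : ℕ) : H) : Gal(Ω/K)) ∈ M.fixingSubgroup := by
      rw [IntermediateField.mem_fixingSubgroup_iff]
      intro y hy
      have := DFunLike.congr_fun hij (⟨y, hy⟩ : M)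
      change ((g ^ (i : ℕ) : H) : Gal(Ω/K)) y = ((g ^ (j : ℕ) : H) : Gal(Ω/K)) y at this
      rw [Subgroup.coe_mul, Subgroup.coe_inv, AlgEquiv.mul_apply, this, ← AlgEquiv.mul_apply,
        inv_mul_cancel, AlgEquiv.one_apply]
    rw [InfiniteGalois.fixingSubgroup_fixedField ⟨N, hf⟩] at h1
    obtain ⟨n, hn, hn'⟩ := h1
    rw [Subgroup.coe_subtype, Subtype.coe_inj] at hn'
    subst hn'
    have h2 : f ((g ^ (j : ℕ))⁻¹ * g ^ (i : ℕ)) = 1 := hn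
    rw [map_mul, map_inv, hg, hg, inv_mul_eq_one] at h2
    have h3 : ((j : ℕ) : ZMod ℓ) = ((i : ℕ) : ZMod ℓ) := h2
    rw [ZMod.natCast_eq_natCast_iff, Nat.ModEq, Nat.mod_eq_of_lt i.2, Nat.mod_eq_of_lt j.2] at h3
    exact Fin.ext h3.symm
  let ξ' : Ω := algebraMap K Ω ξ
  have hξ' : IsPrimitiveRoot ξ' ℓ := hξ.map_of_injective (algebraMap K Ω).injective
  have hξ0 : ξ' ≠ 0 := hξ'.ne_zero hℓ.ne_zero
  have hgξ : ∀ σ : Gal(Ω/K), σ ξ' = ξ' := fun σ => σ.commutes ξ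
  have hli := (linearIndependent_monoidHom M Ω).comp χ hχ
  -- A nonzero Lagrange resolvent `z`: it satisfies `g z = ξ z`, and `z ^ ℓ` is fixed by `H`. An
  -- `ℓ`-th root `w` of `z ^ ℓ` in the fixed field of `H` differs from `z` by a power of `ξ`, which
  -- forces `g z = z`.
  obtain ⟨y, hy⟩ : ∃ y : M, ∑ i ∈ Finset.range ℓ, (ξ' ^ i)⁻¹ * ((g ^ i : H) : Gal(Ω/K)) y ≠ 0 := by
    by_contra! hcon
    have := Fintype.linearIndependent_iff.1 hli (fun i => (ξ' ^ (i : ℕ))⁻¹) (by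
      funext y
      have := hcon y
      rw [← Fin.sum_univ_eq_sum_range (fun i => (ξ' ^ i)⁻¹ * ((g ^ i : H) : Gal(Ω/K)) y)] at this
      simpa [Finset.sum_apply, χ] using this) ⟨0, hℓ.pos⟩
    simp at this
  set z : Ω := ∑ i ∈ Finset.range ℓ, (ξ' ^ i)⁻¹ * ((g ^ i : H) : Gal(Ω/K)) y with hz
  have hgz : (g : Gal(Ω/K)) z = ξ' * z := by
    have h1 : (g : Gal(Ω/K)) z =
        ξ' * ∑ i ∈ Finset.range ℓ, (ξ' ^ (i + 1))⁻¹ * ((g ^ (i + 1) : H) : Gal(Ω/K)) y := by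
      rw [hz, map_sum, Finset.mul_sum]
      refine Finset.sum_congr rfl fun i _ => ?_
      rw [map_mul, map_inv₀, map_pow, hgξ, ← AlgEquiv.mul_apply, ← Subgroup.coe_mul, ← pow_succ',
        ← mul_assoc]
      congr 1
      field_simp
      ring
    rw [h1, hz]
    congr 1
    have h2 := Finset.sum_range_succ (fun i => (ξ' ^ i)⁻¹ * ((g ^ i : H) : Gal(Ω/K)) y) ℓ
    rw [Finset.sum_range_succ'] at h2
    have h3 : ((g ^ ℓ : H) : Gal(Ω/K)) y = y := hM y _ (by rw [hg]; simp)
    simp only [h3, hξ'.pow_eq_one, pow_zero, OneMemClass.coe_one, AlgEquiv.one_apply] at h2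
    exact add_right_cancel h2
  have hNz : ∀ n : H, f n = 1 → (n : Gal(Ω/K)) z = z := by
    intro n hn
    rw [hz, map_sum]
    refine Finset.sum_congr rfl fun i _ => ?_
    rw [map_mul, map_inv₀, map_pow, hgξ]
    congr 1
    have h1 := hM y ((g ^ i)⁻¹ * n * g ^ i) (by rw [map_mul, map_mul, hn, mul_one, map_inv,
      inv_mul_cancel])
    rw [mul_assoc, Subgroup.coe_mul, Subgroup.coe_inv, AlgEquiv.mul_apply, ← AlgEquiv.smul_def,
      inv_smul_eq_iff] at h1
    exact h1
  have hgz' : ∀ i : ℕ, ((g ^ i : H) : Gal(Ω/K)) z = ξ' ^ i * z := by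
    intro i
    induction i with
    | zero => simp
    | succ i ih =>
      rw [pow_succ', Subgroup.coe_mul, AlgEquiv.mul_apply, ih, map_mul, map_pow, hgξ, hgz]
      ring
  have hzH : z ^ ℓ ∈ IntermediateField.fixedField H := by
    rintro ⟨n, hn⟩
    change n (z ^ ℓ) = z ^ ℓ
    let n' : H := ⟨n, hn⟩
    let c := (f n').toAdd.val
    have h1 : f ((g ^ c)⁻¹ * n') = 1 := by
      rw [map_mul, map_inv, hg, inv_mul_eq_one]
      simp [c]
    have h2 := hNz _ h1
    rw [Subgroup.coe_mul, Subgroup.coe_inv, AlgEquiv.mul_apply, ← AlgEquiv.smul_def,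
      inv_smul_eq_iff, AlgEquiv.smul_def, hgz'] at h2
    rw [map_pow, h2, mul_pow, ← pow_mul, mul_comm c, pow_mul, hξ'.pow_eq_one, one_pow, one_mul]
  obtain ⟨w, hw, hwz⟩ := hroot _ hzH
  have hw0 : w ≠ 0 := by
    rintro rfl
    rw [zero_pow hℓ.ne_zero] at hwz
    exact hy (eq_zero_of_pow_eq_zero hwz.symm)
  have : NeZero ℓ := ⟨hℓ.ne_zero⟩
  obtain ⟨i, -, hi⟩ := hξ'.eq_pow_of_pow_eq_one
    (show (z / w) ^ ℓ = 1 by rw [div_pow, hwz, div_self (pow_ne_zero _ hy)])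
  rw [eq_div_iff hw0] at hi
  have h4 : (g : Gal(Ω/K)) z = z := by
    rw [← hi, map_mul, map_pow, hgξ, show (g : Gal(Ω/K)) w = w from hw g]
  rw [h4] at hgz
  exact hξ'.ne_one hℓ.one_lt (mul_right_cancel₀ hy (by rw [one_mul, ← hgz]))

end Kummer

/-! ### The `ℓ`-part of the tame character -/

section TameCharacter

/-- A closed subgroup of `ℤ_ℓ` is an ideal. -/
theorem mul_mem_of_isClosed {ℓ : ℕ} [Fact ℓ.Prime] {C : AddSubgroup ℤ_[ℓ]}
    (hC : IsClosed (C : Set ℤ_[ℓ])) (a : ℤ_[ℓ]) {c : ℤ_[ℓ]} (hc : c ∈ C) : a * c ∈ C := by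
  have h : IsClosed {x : ℤ_[ℓ] | x * c ∈ C} := hC.preimage (continuous_id.mul continuous_const)
  refine PadicInt.denseRange_natCast.induction_on (p := fun x => x * c ∈ C) a h fun n => ?_
  rw [← nsmul_eq_mul]
  exact nsmul_mem hc n

/-- The values of a continuous homomorphism from a compact group to `ℤ_ℓ` on a closed subgroup
form an ideal. -/
theorem exists_mem_toAdd_eq_mul {ℓ : ℕ} [Fact ℓ.Prime] {G : Type*} [Group G] [TopologicalSpace G]
    [CompactSpace G] {χ : G →* Multiplicative ℤ_[ℓ]} (hχ : Continuous fun g => (χ g).toAdd)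
    {S : Subgroup G} (hS : IsClosed (S : Set G)) {τ : G} (hτ : τ ∈ S) (a : ℤ_[ℓ]) :
    ∃ σ ∈ S, (χ σ).toAdd = a * (χ τ).toAdd := by
  let C : AddSubgroup ℤ_[ℓ] := Subgroup.toAddSubgroup' (S.map χ)
  have hC : IsClosed (C : Set ℤ_[ℓ]) := (hS.isCompact.image hχ).isClosed
  exact mul_mem_of_isClosed hC a (c := (χ τ).toAdd) ⟨τ, hτ, rfl⟩

theorem isGalois_of_isSepClosure {k Ω : Type*} [Field k] [Field Ω] [Algebra k⸨X⸩ Ω]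
    [IsSepClosure k⸨X⸩ Ω] : IsGalois k⸨X⸩ Ω :=
  IsSepClosure.isGalois

/-- The uniformizer has no `n`-th root in `k((t))`, for `n > 1`. -/
theorem pow_ne_uniformizer {k : Type*} [Field k] {n : ℕ} (hn : n ≠ 1) (x : k⸨X⸩) : x ^ n ≠ uniformizer k := by
  intro h
  have h1 := congrArg HahnSeries.order h
  rw [HahnSeries.order_pow, uniformizer, HahnSeries.order_single one_ne_zero, nsmul_eq_mul] at h1
  exact hn (by exact_mod_cast Int.eq_one_of_mul_eq_one_right (by positivity) h1)

theorem natCast_prime_ne_zero {p ℓ : ℕ} [Fact p.Prime] [Fact ℓ.Prime] (k : Type*) [Field k]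
    [CharP k p] (hℓ : ℓ ≠ p) : (ℓ : k) ≠ 0 :=
  natCast_ne_zero_of_coprime (p := p) k (by simpa using coprime_pow_of_ne (p := p) hℓ 1)

variable {p ℓ : ℕ} [Fact p.Prime] [Fact ℓ.Prime] {k : Type*} [Field k] [CharP k p] [IsAlgClosed k]

/-- The `ℓ`-part of the tame character of the inertia group. -/
def inertiaExponent (Ω : Type*) [Field Ω] [Algebra k⸨X⸩ Ω] [IsSepClosure k⸨X⸩ Ω]
    {ζ : tameGroup p k} (hζ : IsPrimitiveSystem ζ) (hℓ : ℓ ≠ p) :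
    Gal(Ω/k⸨X⸩) →* Multiplicative ℤ_[ℓ] :=
  (tameExponent hζ hℓ).comp (tameProjection p k Ω)

variable {Ω : Type*} [Field Ω] [Algebra k⸨X⸩ Ω] [IsSepClosure k⸨X⸩ Ω]
  {ζ : tameGroup p k} (hζ : IsPrimitiveSystem ζ) (hℓ : ℓ ≠ p)

theorem continuous_inertiaExponent :
    Continuous fun σ : Gal(Ω/k⸨X⸩) => (inertiaExponent Ω hζ hℓ σ).toAdd :=
  continuous_tameExponent hζ hℓ

theorem isClosed_ker_inertiaExponent :
    IsClosed ((inertiaExponent Ω hζ hℓ).ker : Set Gal(Ω/k⸨X⸩)) :=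
  isClosed_singleton.preimage (continuous_inertiaExponent hζ hℓ)

theorem kummer_eq_pow_inertiaExponent (m : ℕ) (σ : Gal(Ω/k⸨X⸩)) :
    kummer (coprime_pow_of_ne hℓ m) σ = ζ.1 (primePowIndex hℓ m) ^
      (PadicInt.toZModPow m (inertiaExponent Ω hζ hℓ σ).toAdd).val :=
  tameExponent_spec hζ hℓ (tameProjection p k Ω σ) m

/-- Otherwise an `ℓ`-th root of `t` would be Galois-invariant, hence in `k((t))`, contradicting the
order of `t`. -/
theorem exists_kummer_ne_one : ∃ σ : Gal(Ω/k⸨X⸩), kummer (coprime_pow_of_ne hℓ 1) σ ≠ 1 := by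
  have := isGalois_of_isSepClosure (k := k) (Ω := Ω)
  obtain ⟨y, hy⟩ := exists_root_uniformizer (Ω := Ω) (k := k) (coprime_pow_of_ne hℓ 1)
  by_contra! h
  obtain ⟨x, hx⟩ := (InfiniteGalois.mem_range_algebraMap_iff_fixed (k := k⸨X⸩) y).2 fun σ => by
    rw [kummer_spec (coprime_pow_of_ne hℓ 1) σ hy, h σ]
    simp
  refine pow_ne_uniformizer (k := k) (n := ℓ ^ 1) (by simpa using (Fact.out : ℓ.Prime).ne_one) x
    ((algebraMap k⸨X⸩ Ω).injective ?_)
  rw [map_pow, hx, hy]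

/-- The image of the character is an ideal of `ℤ_ℓ`, and it contains a unit because the character is
nontrivial modulo `ℓ`. -/
theorem exists_inertiaExponent_eq_one :
    ∃ σ : Gal(Ω/k⸨X⸩), (inertiaExponent Ω hζ hℓ σ).toAdd = 1 := by
  have := isGalois_of_isSepClosure (k := k) (Ω := Ω)
  obtain ⟨τ, hτ⟩ := exists_kummer_ne_one (Ω := Ω) (k := k) hℓ
  have h1 : IsUnit (inertiaExponent Ω hζ hℓ τ).toAdd := by
    rw [PadicInt.isUnit_iff]
    by_contra h
    have h2 := lt_of_le_of_ne (PadicInt.norm_le_one _) h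
    rw [PadicInt.norm_lt_one_iff_dvd, ← pow_one (ℓ : ℤ_[ℓ]), ← Ideal.mem_span_singleton,
      ← PadicInt.ker_toZModPow, RingHom.mem_ker] at h2
    apply hτ
    rw [kummer_eq_pow_inertiaExponent hζ hℓ, h2]
    simp
  obtain ⟨u, hu⟩ := h1
  obtain ⟨σ, -, hσ⟩ := exists_mem_toAdd_eq_mul (continuous_inertiaExponent hζ hℓ) (S := ⊤) isClosed_univ
    (Subgroup.mem_top τ) (↑u⁻¹ : ℤ_[ℓ])
  exact ⟨σ, by rw [hσ, ← hu, Units.inv_mul]⟩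

/-- A closed subgroup of the kernel of the `ℓ`-part of the tame character has no continuous
characters of order `ℓ`. -/
theorem eq_one_of_le_ker_inertiaExponent {H : Subgroup Gal(Ω/k⸨X⸩)}
    (hH : H ≤ (inertiaExponent Ω hζ hℓ).ker) (f : H →* Multiplicative (ZMod ℓ))
    (hf : IsClosed ((f.ker.map H.subtype : Subgroup Gal(Ω/k⸨X⸩)) : Set Gal(Ω/k⸨X⸩))) (h : H) :
    f h = 1 := by
  have := isGalois_of_isSepClosure (k := k) (Ω := Ω)
  have hξ : IsPrimitiveRoot (HahnSeries.C (ζ.1 (primePowIndex hℓ 1) : k) : k⸨X⸩) ℓ := by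
    have := (IsPrimitiveRoot.coe_units_iff.2 (hζ (primePowIndex hℓ 1))).map_of_injective
      (HahnSeries.C_injective (Γ := ℤ) (R := k))
    simpa [primePowIndex] using this
  refine eq_one_of_isClosed_ker hξ H (fun x hx => ?_) f hf h
  refine exists_pow_eq_of_mem_intermediateField Fact.out (natCast_prime_ne_zero (p := p) k hℓ) _
    (fun m y hy => ?_) hx
  -- On the kernel all Kummer characters of `ℓ`-power level vanish, so the fixed field of `H`
  -- contains the `ℓ`-power roots of `t`.
  rintro ⟨σ, hσ⟩
  change σ y = y
  have h1 := kummer_eq_pow_inertiaExponent hζ hℓ m σ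
  rw [hH hσ] at h1
  rw [kummer_spec (coprime_pow_of_ne hℓ m) σ hy, h1]
  simp

end TameCharacter

/-! ### Finiteness of the image of the prime-to-`ℓ` part -/

section Monodromy

theorem norm_natCast_prime_lt_one (ℓ : ℕ) [Fact ℓ.Prime] : ‖(ℓ : PadicAlgCl ℓ)‖ < 1 := by
  have h := PadicAlgCl.norm_extends ℓ (ℓ : ℚ_[ℓ])
  rw [map_natCast] at h
  rw [h]
  exact Padic.norm_p_lt_one

theorem exists_addMonoidHom_apply_ne_zero {F A : Type*} [Field F] [AddCommGroup A] [Module F A]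
    {a : A} (ha : a ≠ 0) : ∃ φ : A →+ F, φ a ≠ 0 := by
  by_contra! h
  have h1 : ∀ φ : Module.Dual F A, φ a = 0 := fun φ => h φ.toAddMonoidHom
  exact ha ((Module.forall_dual_apply_eq_zero_iff F a).1 h1)

theorem exists_addMonoidHom_zmod_apply_ne_zero {ℓ : ℕ} [Fact ℓ.Prime] {A : Type*} [AddCommGroup A]
    (hA : ∀ a : A, ℓ • a = 0) {a : A} (ha : a ≠ 0) : ∃ φ : A →+ ZMod ℓ, φ a ≠ 0 :=
  @exists_addMonoidHom_apply_ne_zero (ZMod ℓ) A _ _ (AddCommGroup.zmodModule hA) a ha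

/-- A compact group without continuous characters of order `ℓ` has no nontrivial representations
by `ℓ`-adic matrices congruent to `1`. -/
theorem eq_one_of_forall_norm_sub_one_lt {ℓ : ℕ} [Fact ℓ.Prime] {H : Type*} [Group H]
    [TopologicalSpace H] [CompactSpace H] [IsTopologicalGroup H] {ι : Type*} [Fintype ι]
    [DecidableEq ι] (M : H →* Matrix ι ι (PadicAlgCl ℓ)) (hM : Continuous M)
    (hlt : ∀ h i j, ‖(M h - 1) i j‖ < 1)
    (hH : ∀ f : H →* Multiplicative (ZMod ℓ), IsOpen (f.ker : Set H) → ∀ h, f h = 1) (h : H) :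
    M h = 1 := by
  let E := PadicAlgCl ℓ
  by_contra hne
  have hcont : ∀ i j, Continuous fun g => (M g - 1) i j := fun i j =>
    (hM.sub continuous_const).matrix_elem i j
  -- By compactness the largest norm `r` of an entry of `M g - 1` is attained, say at the entry `q`,
  -- so that `0 < r < 1`.
  have hmax : ∀ q : ι × ι, ∃ g : H, ∀ g', ‖(M g' - 1) q.1 q.2‖ ≤ ‖(M g - 1) q.1 q.2‖ := fun q => by
    obtain ⟨g, -, hg⟩ := isCompact_univ.exists_isMaxOn (s := (Set.univ : Set H)) ⟨1, trivial⟩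
      (hcont q.1 q.2).norm.continuousOn
    exact ⟨g, fun g' => hg (Set.mem_univ g')⟩
  choose g hg using hmax
  obtain ⟨i, j, hij⟩ : ∃ i j, (M h - 1) i j ≠ 0 := by
    by_contra! hz
    exact hne (sub_eq_zero.1 (Matrix.ext hz))
  obtain ⟨q, -, hq⟩ := Finset.exists_max_image Finset.univ
    (fun q : ι × ι => ‖(M (g q) - 1) q.1 q.2‖) ⟨(i, j), Finset.mem_univ _⟩
  set r : ℝ := ‖(M (g q) - 1) q.1 q.2‖ with hr
  have hle : ∀ g' i j, ‖(M g' - 1) i j‖ ≤ r := fun g' i j =>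
    (hg (i, j) g').trans (hq (i, j) (Finset.mem_univ _))
  have hr0 : 0 < r := (norm_pos_iff.2 hij).trans_le (hle h i j)
  have hr1 : r < 1 := hlt _ _ _
  -- The closed ball of radius `r` modulo the open one is killed by `ℓ`, since `‖ℓ‖ < 1`.
  let B : AddSubgroup E :=
    { carrier := {x | ‖x‖ ≤ r}
      zero_mem' := by simpa using hr0.le
      add_mem' := fun {x y} hx hy => (IsUltrametricDist.norm_add_le_max x y).trans (max_le hx hy)
      neg_mem' := fun {x} hx => by simpa using hx }
  let S : AddSubgroup B :=
    { carrier := {x | ‖(x : E)‖ < r}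
      zero_mem' := by simpa using hr0
      add_mem' := fun {x y} hx hy =>
        (IsUltrametricDist.norm_add_le_max (x : E) y).trans_lt (max_lt hx hy)
      neg_mem' := fun {x} hx => by simpa using hx }
  let A := B ⧸ S
  have hA : ∀ a : A, ℓ • a = 0 := by
    intro a
    obtain ⟨x, rfl⟩ := QuotientAddGroup.mk_surjective a
    rw [← QuotientAddGroup.mk_nsmul, QuotientAddGroup.eq_zero_iff]
    change ‖((ℓ • x : B) : E)‖ < r
    rw [AddSubgroup.coe_nsmul, nsmul_eq_mul, norm_mul]
    calc ‖(ℓ : E)‖ * ‖(x : E)‖ ≤ ‖(ℓ : E)‖ * r := by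
          have : ‖(x : E)‖ ≤ r := x.2
          gcongr
      _ < 1 * r := by
          have := norm_natCast_prime_lt_one ℓ
          gcongr
      _ = r := one_mul r
  let c : H → B := fun g' => ⟨(M g' - 1) q.1 q.2, hle _ _ _⟩
  -- `M (ab) - 1` differs from the sum of `M a - 1` and `M b - 1` by their product, whose entries
  -- have norm at most `r² < r`; so the entry `q` is additive modulo `S`.
  have hc : ∀ a b, (QuotientAddGroup.mk (c (a * b)) : A) = QuotientAddGroup.mk (c a + c b) := by
    intro a b
    rw [QuotientAddGroup.eq, add_comm, ← sub_eq_add_neg]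
    refine AddSubgroup.neg_mem_iff _ |>.1 ?_
    change ‖((-(c a + c b - c (a * b)) : B) : E)‖ < r
    have h1 : ((-(c a + c b - c (a * b)) : B) : E) = ((M a - 1) * (M b - 1)) q.1 q.2 := by
      have : (M a - 1) * (M b - 1) = (M (a * b) - 1) - ((M a - 1) + (M b - 1)) := by
        rw [map_mul]
        noncomm_ring
      rw [this]
      simp [c]
    rw [h1, Matrix.mul_apply]
    refine lt_of_le_of_lt (b := r * r) ?_ (by nlinarith)
    refine IsUltrametricDist.norm_sum_le_of_forall_le_of_nonneg (by positivity) fun m _ => ?_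
    rw [norm_mul]
    exact mul_le_mul (hle _ _ _) (hle _ _ _) (norm_nonneg _) hr0.le
  have hne : (QuotientAddGroup.mk (c (g q)) : A) ≠ 0 := by
    rw [Ne, QuotientAddGroup.eq_zero_iff]
    exact lt_irrefl r
  obtain ⟨φ, hφ⟩ := exists_addMonoidHom_zmod_apply_ne_zero hA hne
  let f : H →* Multiplicative (ZMod ℓ) := MonoidHom.mk'
    (fun g' => Multiplicative.ofAdd (φ (QuotientAddGroup.mk (c g')))) fun a b => by
      rw [hc, QuotientAddGroup.mk_add, map_add, ofAdd_add]
  refine hφ (hH f ?_ (g q))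
  refine Subgroup.isOpen_of_mem_nhds _ (g := 1) ?_
  have h1 : {g' : H | ‖(M g' - 1) q.1 q.2‖ < r} ∈ nhds (1 : H) :=
    ((isOpen_Iio (a := r)).preimage (hcont q.1 q.2).norm).mem_nhds (by simpa using hr0)
  filter_upwards [h1] with g' hg'
  change Multiplicative.ofAdd (φ (QuotientAddGroup.mk (c g'))) = 1
  rw [(QuotientAddGroup.eq_zero_iff (c g')).2 hg', map_zero, ofAdd_zero]

variable {p ℓ : ℕ} [Fact p.Prime] [Fact ℓ.Prime] {k : Type*} [Field k] [CharP k p] [IsAlgClosed k]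
  {Ω : Type*} [Field Ω] [Algebra k⸨X⸩ Ω] [IsSepClosure k⸨X⸩ Ω]
  {ζ : tameGroup p k} (hζ : IsPrimitiveSystem ζ) (hℓ : ℓ ≠ p)
  {V : Type*} [AddCommGroup V] [Module (PadicAlgCl ℓ) V]

/-- An `ℓ`-adic representation of the inertia group is trivial on the intersection of an open
subgroup with the kernel of the `ℓ`-part of the tame character. -/
theorem exists_openNormalSubgroup_forall_eq_one
    {ρ : Representation (PadicAlgCl ℓ) Gal(Ω/k⸨X⸩) V} (hρ : IsContinuousRep ρ) :
    ∃ N : OpenNormalSubgroup Gal(Ω/k⸨X⸩),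
      ∀ σ ∈ N, (inertiaExponent Ω hζ hℓ σ).toAdd = 0 → ρ σ = 1 := by
  have := isGalois_of_isSepClosure (k := k) (Ω := Ω)
  have := hρ.finite
  let b := Module.finBasis (PadicAlgCl ℓ) V
  have hM := (isContinuousRep_iff b ρ).1 hρ
  let M : Gal(Ω/k⸨X⸩) →* Matrix _ _ (PadicAlgCl ℓ) :=
    (LinearMap.toMatrixAlgEquiv b).toMulEquiv.toMonoidHom.comp ρ
  have hM : Continuous M := hM
  let O : Set Gal(Ω/k⸨X⸩) := ⋂ i, ⋂ j, {σ | ‖(M σ - 1) i j‖ < 1}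
  have hO : IsOpen O := isOpen_iInter_of_finite fun i => isOpen_iInter_of_finite fun j =>
    isOpen_Iio.preimage ((hM.sub continuous_const).matrix_elem i j).norm
  obtain ⟨N, hN⟩ := ProfiniteGrp.exist_openNormalSubgroup_sub_open_nhds_of_one hO
    (by simp [O])
  refine ⟨N, fun σ hσ hσ' => ?_⟩
  let H : Subgroup Gal(Ω/k⸨X⸩) := N.toSubgroup ⊓ (inertiaExponent Ω hζ hℓ).ker
  have hH : IsClosed (H : Set Gal(Ω/k⸨X⸩)) :=
    (Subgroup.isClosed_of_isOpen _ N.isOpen').inter (isClosed_ker_inertiaExponent hζ hℓ)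
  have : CompactSpace H := isCompact_iff_compactSpace.1 hH.isCompact
  have h1 := eq_one_of_forall_norm_sub_one_lt (M.comp H.subtype)
    (hM.comp continuous_subtype_val) (fun h i j => by
      have := hN h.2.1
      simp only [O, Set.mem_iInter] at this
      exact this i j)
    (fun f hf => eq_one_of_le_ker_inertiaExponent hζ hℓ inf_le_right f
      (by
        have h2 := Subgroup.isClosed_of_isOpen f.ker hf
        exact hH.isClosedMap_subtype_val _ h2))
    ⟨σ, hσ, hσ'⟩
  exact (LinearMap.toMatrixAlgEquiv b).injective (h1.trans (map_one _).symm)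

end Monodromy

/-! ### Binomial powers of unipotent elements -/

section BinomialPow

variable {R E A : Type*} [CommRing R] [BinomialRing R] [CommRing E] [Ring A] [Algebra E A]

/-- The truncated binomial series `∑ k < n, (a choose k) • x ^ k`, which is `(1 + x) ^ a` when
`x ^ n = 0`. -/
def binomialPow (φ : R →+* E) (x : A) (n : ℕ) (a : R) : A :=
  ∑ k ∈ Finset.range n, φ (Ring.choose a k) • x ^ k

/-- The polynomial underlying `binomialPow`. -/
def binomialPoly (φ : R →+* E) (n : ℕ) (a : R) : Polynomial E :=
  ∑ k ∈ Finset.range n, Polynomial.C (φ (Ring.choose a k)) * Polynomial.X ^ k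

theorem aeval_binomialPoly (φ : R →+* E) (x : A) (n : ℕ) (a : R) :
    Polynomial.aeval x (binomialPoly φ n a) = binomialPow φ x n a := by
  simp [binomialPoly, binomialPow, Algebra.smul_def]

theorem coeff_binomialPoly (φ : R →+* E) (n : ℕ) (a : R) {d : ℕ} (hd : d < n) :
    (binomialPoly φ n a).coeff d = φ (Ring.choose a d) := by
  simp [binomialPoly, Polynomial.coeff_X_pow, hd]

/-- Vandermonde's identity for binomial coefficients, read as a congruence of polynomials modulo `X
^ n` and evaluated at `x`. -/
theorem binomialPow_add (φ : R →+* E) {x : A} {n : ℕ} (hx : x ^ n = 0) (a b : R) :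
    binomialPow φ x n (a + b) = binomialPow φ x n a * binomialPow φ x n b := by
  have h : Polynomial.X ^ n ∣ binomialPoly φ n (a + b) - binomialPoly φ n a * binomialPoly φ n b := by
    rw [Polynomial.X_pow_dvd_iff]
    intro d hd
    rw [Polynomial.coeff_sub, Polynomial.coeff_mul, coeff_binomialPoly φ n _ hd,
      Ring.add_choose_eq _ (Commute.all a b), map_sum, sub_eq_zero]
    refine Finset.sum_congr rfl fun q hq => ?_
    rw [Finset.HasAntidiagonal.mem_antidiagonal] at hq
    rw [coeff_binomialPoly φ n _ (by omega), coeff_binomialPoly φ n _ (by omega), map_mul]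
  obtain ⟨Q, hQ⟩ := h
  have := congrArg (Polynomial.aeval x) hQ
  rw [map_sub, map_mul, map_mul, map_pow, Polynomial.aeval_X, hx, zero_mul, aeval_binomialPoly,
    aeval_binomialPoly, aeval_binomialPoly] at this
  exact sub_eq_zero.1 this

theorem binomialPow_zero (φ : R →+* E) {x : A} {n : ℕ} (hx : x ^ n = 0) :
    binomialPow φ x n 0 = 1 := by
  -- For `n = 0` the hypothesis says `1 = 0`, so the empty sum is still 1.
  cases n with
  | zero =>
    rw [pow_zero] at hx
    rw [hx]
    rfl
  | succ n =>
    rw [binomialPow, Finset.sum_range_succ', Finset.sum_eq_zero]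
    · simp
    · intro k _
      rw [Ring.choose_zero_succ, map_zero, zero_smul]

theorem binomialPow_one (φ : R →+* E) {x : A} {n : ℕ} (hx : x ^ n = 0) :
    binomialPow φ x n 1 = 1 + x := by
  have key : ∀ m : ℕ, Ring.choose (1 : R) m = (Nat.choose 1 m : R) := fun m => by
    rw [← Ring.choose_natCast, Nat.cast_one]
  match n with
  | 0 =>
    rw [pow_zero] at hx
    exact (subsingleton_of_zero_eq_one hx.symm).elim _ _
  | 1 =>
    rw [pow_one] at hx
    simp [binomialPow, hx]
  | n + 2 =>
    rw [binomialPow, Finset.sum_range_succ', Finset.sum_range_succ', Finset.sum_eq_zero]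
    · simp [add_comm]
    · intro k _
      rw [key, Nat.choose_eq_zero_of_lt (by omega)]
      simp

theorem binomialPow_nsmul (φ : R →+* E) {x : A} {n : ℕ} (hx : x ^ n = 0) (m : ℕ) (a : R) :
    binomialPow φ x n (m • a) = binomialPow φ x n a ^ m := by
  induction m with
  | zero => rw [zero_smul, binomialPow_zero φ hx, pow_zero]
  | succ m ih => rw [succ_nsmul, binomialPow_add φ hx, ih, pow_succ]

theorem binomialPow_natCast (φ : R →+* E) {x : A} {n : ℕ} (hx : x ^ n = 0) (m : ℕ) :
    binomialPow φ x n (m : R) = (1 + x) ^ m := by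
  rw [← nsmul_one, binomialPow_nsmul φ hx, binomialPow_one φ hx]

theorem commute_binomialPow (φ : R →+* E) {x y : A} (h : Commute x y) (n : ℕ) (a : R) :
    Commute (binomialPow φ x n a) y :=
  Commute.sum_left _ _ _ fun k _ => (h.pow_left k).smul_left _

/-- A unipotent element has an `m`-th root, which commutes with everything it commutes with. -/
theorem exists_unipotent_root {E A : Type*} [Field E] [CharZero E] [Ring A] [Algebra E A]
    {y : A} (hy : IsNilpotent y) {m : ℕ} (hm : m ≠ 0) :
    ∃ x : A, IsNilpotent x ∧ (1 + x) ^ m = 1 + y ∧ ∀ z, Commute y z → Commute x z := by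
  obtain ⟨n, hn⟩ := hy
  let φ := algebraMap ℚ E
  have hn' : y ^ (n + 1) = 0 := by rw [pow_succ, hn, zero_mul]
  -- The root is `(1 + y) ^ (1/m)`, a binomial series with rational exponent. Its constant term is
  -- 1, so `w - 1` is a multiple of `y`, hence nilpotent.
  let w := binomialPow φ y (n + 1) (m : ℚ)⁻¹
  have hw : ∀ z, Commute y z → Commute w z := fun z hz => commute_binomialPow φ hz _ _
  obtain ⟨Q, hQ⟩ : Polynomial.X ∣ binomialPoly φ (n + 1) (m : ℚ)⁻¹ - 1 := by
    rw [Polynomial.X_dvd_iff, Polynomial.coeff_sub, coeff_binomialPoly φ _ _ (Nat.succ_pos n)]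
    simp
  have hwQ : w - 1 = y * Polynomial.aeval y Q := by
    have := congrArg (Polynomial.aeval y) hQ
    rw [map_sub, aeval_binomialPoly, map_mul, map_one, Polynomial.aeval_X] at this
    exact this
  refine ⟨w - 1, ?_, ?_, fun z hz => (hw z hz).sub_left (Commute.one_left z)⟩
  · rw [hwQ]
    refine Commute.isNilpotent_mul_right ?_ ⟨n, hn⟩
    exact Commute.symm (Polynomial.aeval_eq_sum_range (p := Q) y ▸
      Commute.sum_left _ _ _ fun k _ => ((Commute.refl y).pow_left k).smul_left _)
  · rw [add_sub_cancel, ← binomialPow_nsmul φ hn', nsmul_eq_mul,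
      mul_inv_cancel₀ (Nat.cast_ne_zero.2 hm), binomialPow_one φ hn']

end BinomialPow

/-! ### Averaging -/

section Averaging

variable {E G V : Type*} [Field E] [CharZero E] [Group G] [AddCommGroup V] [Module E V]

/-- Invariant subspaces of a representation under which a subgroup of finite index acts by central
elements have equivariant projections. -/
theorem exists_equivariant_projection (ρ : Representation E G V) (S : Subgroup G) [S.FiniteIndex]
    (hS : ∀ s ∈ S, ∀ f : Module.End E V, Commute (ρ s) f) (A : Submodule E V)
    (hA : ∀ g, ∀ v ∈ A, ρ g v ∈ A) :
    ∃ π : Module.End E V, (∀ g, Commute (ρ g) π) ∧ (∀ v, π v ∈ A) ∧ ∀ v ∈ A, π v = v := by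
  obtain ⟨q, hq⟩ := A.subtype.exists_leftInverse_of_injective A.ker_subtype
  let π₀ : Module.End E V := A.subtype ∘ₗ q
  have h1 : ∀ v ∈ A, π₀ v = v := fun v hv =>
    congrArg Subtype.val (LinearMap.congr_fun hq ⟨v, hv⟩)
  have h2 : ∀ v, π₀ v ∈ A := fun v => (q v).2
  let c : G → Module.End E V := fun g => ρ g * π₀ * ρ g⁻¹
  have hinv : ∀ g, ρ g⁻¹ * ρ g = 1 := fun g => by rw [← map_mul, inv_mul_cancel, map_one]
  have hinv' : ∀ g, ρ g * ρ g⁻¹ = 1 := fun g => by rw [← map_mul, mul_inv_cancel, map_one]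
  -- The conjugate `c g` depends only on the coset `gS`, as `S` acts centrally; the projection
  -- sought is the average of these conjugates.
  let d : G ⧸ S → Module.End E V := Quotient.lift c fun a b hab => by
    have hs := QuotientGroup.leftRel_apply.1 hab
    have h3 : ρ b = ρ a * ρ (a⁻¹ * b) := by rw [← map_mul, mul_inv_cancel_left]
    have h4 : ρ b⁻¹ = ρ (a⁻¹ * b)⁻¹ * ρ a⁻¹ := by
      rw [← map_mul]
      congr 1
      group
    change ρ a * π₀ * ρ a⁻¹ = ρ b * π₀ * ρ b⁻¹
    rw [h3, h4, mul_assoc (ρ a) (ρ _) π₀, (hS _ hs π₀).eq]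
    simp only [mul_assoc]
    rw [← mul_assoc (ρ (a⁻¹ * b)), hinv', one_mul]
  have hd : ∀ g x, ρ g * d x * ρ g⁻¹ = d (g • x) := by
    intro g x
    induction x using QuotientGroup.induction_on with
    | H x =>
      change ρ g * (ρ x * π₀ * ρ x⁻¹) * ρ g⁻¹ = ρ (g * x) * π₀ * ρ (g * x)⁻¹
      rw [mul_inv_rev, map_mul, map_mul]
      simp only [mul_assoc]
  have : Fintype (G ⧸ S) := Fintype.ofFinite _
  have hcard : (Fintype.card (G ⧸ S) : E) ≠ 0 := Nat.cast_ne_zero.2 Fintype.card_ne_zero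
  have hdA : ∀ x v, d x v ∈ A := by
    intro x v
    induction x using QuotientGroup.induction_on with
    | H x => exact hA _ _ (h2 _)
  have hdA' : ∀ x, ∀ v ∈ A, d x v = v := by
    intro x v hv
    induction x using QuotientGroup.induction_on with
    | H x =>
      change ρ x (π₀ (ρ x⁻¹ v)) = v
      rw [h1 _ (hA _ _ hv)]
      exact LinearMap.congr_fun (hinv' x) v
  refine ⟨(Fintype.card (G ⧸ S) : E)⁻¹ • ∑ x, d x, fun g => ?_, fun v => ?_, fun v hv => ?_⟩
  · refine Commute.smul_right ?_ _
    have h3 : ρ g * (∑ x, d x) * ρ g⁻¹ = ∑ x, d x := by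
      rw [Finset.mul_sum, Finset.sum_mul]
      simp only [hd]
      exact Fintype.sum_equiv (MulAction.toPerm g) _ _ fun x => rfl
    change ρ g * (∑ x, d x) = (∑ x, d x) * ρ g
    conv_rhs => rw [← h3]
    rw [mul_assoc, hinv, mul_one]
  · rw [LinearMap.smul_apply, LinearMap.sum_apply]
    exact A.smul_mem _ (A.sum_mem fun x _ => hdA x v)
  · rw [LinearMap.smul_apply, LinearMap.sum_apply, Finset.sum_congr rfl fun x _ => hdA' x v hv,
      Finset.sum_const, Finset.card_univ, ← Nat.cast_smul_eq_nsmul E, smul_smul,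
      inv_mul_cancel₀ hcard, one_smul]

end Averaging

/-! ### The decomposition of an indecomposable representation into a semisimple and a unipotent one -/

section Decomposition

/-- Fitting's decomposition for `T - c`, with `c` an eigenvalue, is invariant under `ρ`. Its kernel
part is nonzero, so its range part vanishes. -/
theorem IsIndecomposable.exists_isNilpotent_sub {E G V : Type*} [Field E] [IsAlgClosed E] [Group G]
    [AddCommGroup V] [Module E V] [FiniteDimensional E V] {ρ : Representation E G V}
    (hρ : IsIndecomposable ρ) {T : Module.End E V} (hT : ∀ g, Commute T (ρ g)) :
    ∃ c : E, IsNilpotent (T - algebraMap E _ c) := by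
  have := hρ.1
  obtain ⟨c, hc⟩ := Module.End.exists_eigenvalue T
  let D := T - algebraMap E _ c
  have hD : ∀ n g, Commute (D ^ n) (ρ g) := fun n g =>
    ((hT g).sub_left (Algebra.commute_algebraMap_left _ _)).pow_left n
  obtain ⟨n, hn⟩ := Filter.eventually_atTop.1 (LinearMap.eventually_isCompl_ker_pow_range_pow D)
  let A : Subrepresentation ρ := ⟨LinearMap.ker (D ^ (n + 1)), fun g v hv => by
    rw [LinearMap.mem_ker] at hv ⊢
    rw [← Module.End.mul_apply, (hD _ g).eq, Module.End.mul_apply, hv, map_zero]⟩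
  let B : Subrepresentation ρ := ⟨LinearMap.range (D ^ (n + 1)), by
    rintro g _ ⟨v, rfl⟩
    exact ⟨ρ g v, by rw [← Module.End.mul_apply, (hD _ g).eq, Module.End.mul_apply]⟩⟩
  refine ⟨c, n + 1, ?_⟩
  rcases hρ.2 A B (hn (n + 1) n.le_succ) with h | h
  · exfalso
    obtain ⟨v, hv⟩ := hc.exists_hasEigenvector
    have hv' : v ∈ A.toSubmodule := by
      change (D ^ (n + 1)) v = 0
      have hDv : D v = 0 := by
        simp [D, hv.apply_eq_smul, Algebra.algebraMap_eq_smul_one]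
      rw [pow_succ, Module.End.mul_apply, hDv, map_zero]
    rw [h, Submodule.mem_bot] at hv'
    exact hv.2 hv'
  · exact LinearMap.range_eq_bot.1 h

/-- Twisting a representation by the powers of a commuting unipotent automorphism. -/
def twist {ℓ : ℕ} [Fact ℓ.Prime] {G V : Type*} [Group G] [AddCommGroup V]
    [Module (PadicAlgCl ℓ) V] (ρ : Representation (PadicAlgCl ℓ) G V)
    (χ : G →* Multiplicative ℤ_[ℓ]) (x : Module.End (PadicAlgCl ℓ) V) (n : ℕ) (hx : x ^ n = 0)
    (hxρ : ∀ g, Commute x (ρ g)) : Representation (PadicAlgCl ℓ) G V where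
  toFun g := ρ g * binomialPow (padicToAlgCl ℓ) x n (-(χ g).toAdd)
  map_one' := by simp [binomialPow_zero _ hx]
  map_mul' g h := by
    rw [map_mul, map_mul, toAdd_mul, neg_add, binomialPow_add _ hx, mul_assoc, mul_assoc,
      ← mul_assoc (ρ h), ← mul_assoc (binomialPow _ x n _) (ρ h),
      (commute_binomialPow _ (hxρ h) n _).eq]

theorem _root_.PadicInt.dvd_of_norm_le {ℓ : ℕ} [Fact ℓ.Prime] {a b : ℤ_[ℓ]} (hb : b ≠ 0)
    (h : ‖a‖ ≤ ‖b‖) : b ∣ a := by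
  have hb' : (b : ℚ_[ℓ]) ≠ 0 := PadicInt.coe_ne_zero.2 hb
  refine ⟨⟨a / b, ?_⟩, PadicInt.ext ?_⟩
  · rw [norm_div, ← PadicInt.norm_def, ← PadicInt.norm_def]
    exact div_le_one_of_le₀ h (norm_nonneg b)
  · exact (mul_div_cancel₀ (a : ℚ_[ℓ]) hb').symm

variable {ℓ : ℕ} [Fact ℓ.Prime] {G V : Type*} [Group G] [TopologicalSpace G]
  [AddCommGroup V] [Module (PadicAlgCl ℓ) V]

/-- Such a coefficient is a finite sum of coefficients of `ρ` times binomial coefficients, which are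
continuous functions on `ℤ_ℓ`. -/
theorem continuous_coeff_twist {ρ : Representation (PadicAlgCl ℓ) G V} (hρ : IsContinuousRep ρ)
    {χ : G →* Multiplicative ℤ_[ℓ]} (hχ : Continuous fun g => (χ g).toAdd)
    {x : Module.End (PadicAlgCl ℓ) V} {n : ℕ} (hx : x ^ n = 0) (hxρ : ∀ g, Commute x (ρ g))
    (φ : Module.Dual (PadicAlgCl ℓ) V) (v : V) :
    Continuous fun g => φ (twist ρ χ x n hx hxρ g v) := by
  have h : ∀ g, φ (twist ρ χ x n hx hxρ g v) = ∑ k ∈ Finset.range n,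
      padicToAlgCl ℓ (Ring.choose (-(χ g).toAdd) k) * φ (ρ g ((x ^ k) v)) := by
    intro g
    change φ ((ρ g * binomialPow (padicToAlgCl ℓ) x n (-(χ g).toAdd)) v) = _
    simp [binomialPow, LinearMap.sum_apply, map_sum]
  simp only [h]
  refine continuous_finsetSum _ fun k _ => Continuous.mul ?_ (hρ.2 φ _)
  exact (continuous_padicToAlgCl ℓ).comp ((PadicInt.continuous_choose (p := ℓ) k).comp hχ.neg)

/-- An indecomposable representation that is trivial on an open subgroup of the kernel of
`χ : G → ℤ_ℓ` is a semisimple representation twisted by a unipotent one. -/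
theorem IsIndecomposable.exists_twist [IsTopologicalGroup G] [CompactSpace G]
    {ρ : Representation (PadicAlgCl ℓ) G V}
    (hρ : IsContinuousRep ρ) (hind : IsIndecomposable ρ) {χ : G →* Multiplicative ℤ_[ℓ]}
    (hχ : Continuous fun g => (χ g).toAdd) {σ : G} (hσ : (χ σ).toAdd = 1)
    (N : OpenNormalSubgroup G) (hN : ∀ g ∈ N, (χ g).toAdd = 0 → ρ g = 1) :
    ∃ x : Module.End (PadicAlgCl ℓ) V, IsNilpotent x ∧ ∃ hxρ : ∀ g, Commute x (ρ g),
      ∀ (n : ℕ) (hx : x ^ n = 0) (A : Submodule (PadicAlgCl ℓ) V),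
        (∀ g, ∀ v ∈ A, twist ρ χ x n hx hxρ g v ∈ A) →
        ∃ π : Module.End (PadicAlgCl ℓ) V, (∀ g, Commute (twist ρ χ x n hx hxρ g) π) ∧
          (∀ v, π v ∈ A) ∧ ∀ v ∈ A, π v = v := by
  have := hρ.finite
  have := hind.1
  have hfi : N.toSubgroup.FiniteIndex :=
    have := Subgroup.quotient_finite_of_isOpen N.toSubgroup N.isOpen'
    Subgroup.finiteIndex_of_finite_quotient
  let m := N.toSubgroup.index
  have hm : m ≠ 0 := hfi.index_ne_zero
  have hσm : σ ^ m ∈ N.toSubgroup := N.toSubgroup.pow_index_mem σ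
  have hχσ : (χ (σ ^ m)).toAdd = m := by rw [map_pow, toAdd_pow, hσ, nsmul_one]
  -- The commutator of `g` and `σ ^ m` lies in `N` and in the kernel of `χ`, where `ρ` is trivial.
  have hT : ∀ g, Commute (ρ (σ ^ m)) (ρ g) := by
    intro g
    have h1 : ρ (g * σ ^ m * g⁻¹ * (σ ^ m)⁻¹) = 1 := by
      refine hN _ (mul_mem (N.isNormal'.conj_mem _ hσm g) (inv_mem hσm)) ?_
      simp only [map_mul, map_inv, toAdd_mul, toAdd_inv]
      ring
    have h2 : ρ g * ρ (σ ^ m) = ρ (g * σ ^ m * g⁻¹ * (σ ^ m)⁻¹) * (ρ (σ ^ m) * ρ g) := by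
      simp only [← map_mul]
      congr 1
      group
    rw [h1, one_mul] at h2
    exact h2.symm
  obtain ⟨c, hc⟩ := hind.exists_isNilpotent_sub hT
  have hc0 : c ≠ 0 := by
    rintro rfl
    rw [map_zero, sub_zero] at hc
    refine hc.not_isUnit (IsUnit.of_mul_eq_one (ρ (σ ^ m)⁻¹) ?_)
    rw [← map_mul, mul_inv_cancel, map_one]
  -- As `χ (σ ^ m) = m`, the `m`-th root `1 + x` of the unipotent part is the choice for which the
  -- twist makes `σ ^ m` act by the scalar `c`.
  obtain ⟨x, hxn, hxm, hxc⟩ := exists_unipotent_root (E := PadicAlgCl ℓ)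
    (hc.smul c⁻¹) hm
  have hxm' : c • (1 + x) ^ m = ρ (σ ^ m) := by
    rw [hxm, smul_add, smul_inv_smul₀ hc0, Algebra.algebraMap_eq_smul_one]
    abel
  have hxρ : ∀ g, Commute x (ρ g) := fun g => hxc _
    (((hT g).sub_left (Algebra.commute_algebraMap_left _ _)).smul_left _)
  refine ⟨x, hxn, hxρ, fun n hx A hA => ?_⟩
  let θ := twist ρ χ x n hx hxρ
  -- The elements acting centrally through `θ`: a closed subgroup containing `σ ^ m` and `N ∩ ker
  -- χ`, shown below to be open.
  let S : Subgroup G :=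
    { carrier := {g | ∀ f : Module.End (PadicAlgCl ℓ) V, Commute (θ g) f}
      one_mem' := fun f => by rw [map_one]; exact Commute.one_left f
      mul_mem' := fun {a b} ha hb f => by rw [map_mul]; exact (ha f).mul_left (hb f)
      inv_mem' := fun {a} ha f => by
        have h1 : θ a⁻¹ * θ a = 1 := by rw [← map_mul, inv_mul_cancel, map_one]
        have h2 : θ a * θ a⁻¹ = 1 := by rw [← map_mul, mul_inv_cancel, map_one]
        calc θ a⁻¹ * f = θ a⁻¹ * (f * θ a) * θ a⁻¹ := by rw [mul_assoc, mul_assoc, h2, mul_one]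
          _ = f * θ a⁻¹ := by rw [← (ha f).eq, ← mul_assoc, h1, one_mul] }
  have hSc : IsClosed (S : Set G) := by
    have : (S : Set G) = ⋂ f : Module.End (PadicAlgCl ℓ) V, ⋂ φ : Module.Dual (PadicAlgCl ℓ) V,
        ⋂ v : V, {g | φ (θ g (f v)) = (φ ∘ₗ f) (θ g v)} := by
      ext g
      simp only [Set.mem_iInter]
      constructor
      · intro hg f φ v
        exact congrArg φ (LinearMap.congr_fun (hg f) v)
      · intro hg f
        refine LinearMap.ext fun v => ?_
        rw [← sub_eq_zero, ← Module.forall_dual_apply_eq_zero_iff (PadicAlgCl ℓ)]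
        intro φ
        rw [map_sub, sub_eq_zero]
        exact hg f φ v
    rw [this]
    exact isClosed_iInter fun f => isClosed_iInter fun φ => isClosed_iInter fun v =>
      isClosed_eq (continuous_coeff_twist hρ hχ hx hxρ φ _)
        (continuous_coeff_twist hρ hχ hx hxρ _ v)
  have hS1 : ∀ g ∈ N, (χ g).toAdd = 0 → g ∈ S := by
    intro g hg hg' f
    have : θ g = 1 := by
      change ρ g * binomialPow (padicToAlgCl ℓ) x n (-(χ g).toAdd) = 1
      rw [hN g hg hg', hg', neg_zero, binomialPow_zero _ hx, one_mul]
    rw [this]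
    exact Commute.one_left f
  have hS2 : σ ^ m ∈ S := by
    intro f
    have : θ (σ ^ m) = algebraMap (PadicAlgCl ℓ) _ c := by
      change ρ (σ ^ m) * binomialPow (padicToAlgCl ℓ) x n (-(χ (σ ^ m)).toAdd) = _
      rw [hχσ, ← hxm', ← binomialPow_natCast (padicToAlgCl ℓ) hx m, smul_mul_assoc,
        ← binomialPow_add _ hx, add_neg_cancel, binomialPow_zero _ hx,
        Algebra.algebraMap_eq_smul_one]
    rw [this]
    exact Algebra.commute_algebraMap_left _ _
  have hNc : IsClosed (N.toSubgroup : Set G) := Subgroup.isClosed_of_isOpen _ N.isOpen'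
  have hSo : IsOpen (S : Set G) := by
    refine Subgroup.isOpen_of_mem_nhds _ (g := 1) ?_
    have h1 : (N : Set G) ∈ nhds 1 := N.isOpen'.mem_nhds (one_mem N)
    have h2 : {g : G | ‖(χ g).toAdd‖ < ‖(m : ℤ_[ℓ])‖} ∈ nhds (1 : G) :=
      (isOpen_Iio.preimage hχ.norm).mem_nhds (by simpa using hm)
    -- Near 1, `χ g` is a multiple of `m`, hence equals `χ s` for some `s ∈ S ∩ N`; then `g * s⁻¹`
    -- lies in `N ∩ ker χ`.
    filter_upwards [h1, h2] with g hg hg'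
    obtain ⟨a, ha⟩ : (m : ℤ_[ℓ]) ∣ (χ g).toAdd := PadicInt.dvd_of_norm_le (by exact_mod_cast hm) hg'.le
    obtain ⟨s, ⟨hs, hsN⟩, hs'⟩ := exists_mem_toAdd_eq_mul hχ (S := S ⊓ N.toSubgroup)
      (hSc.inter hNc) ⟨hS2, hσm⟩ a
    rw [hχσ] at hs'
    have h3 : g * s⁻¹ ∈ S := hS1 _ (mul_mem hg (inv_mem hsN)) (by
      rw [map_mul, map_inv, toAdd_mul, toAdd_inv, ha, hs']
      ring)
    simpa using mul_mem h3 hs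
  have : S.FiniteIndex :=
    have := Subgroup.quotient_finite_of_isOpen S hSo
    Subgroup.finiteIndex_of_finite_quotient
  exact exists_equivariant_projection θ S (fun s hs => hs) A hA

end Decomposition

/-! ### Splitting off a Jordan block -/

section JordanSplitting

variable {E V W : Type*} [Field E] [AddCommGroup V] [Module E V] [AddCommGroup W] [Module E W]

/-- The map `W ^ n → V`, `f ↦ ∑ j, x ^ (n - 1 - j) (s (f j))`. -/
def jordanMap (x : Module.End E V) (n : ℕ) (s : W →ₗ[E] V) : (Fin n → W) →ₗ[E] V :=
  ∑ j : Fin n, (x ^ (n - 1 - j)) ∘ₗ s ∘ₗ LinearMap.proj j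

/-- The map `V → W ^ n`, `v ↦ (r (x ^ i v))_i`. -/
def jordanComap (x : Module.End E V) (n : ℕ) (r : V →ₗ[E] W) : V →ₗ[E] (Fin n → W) :=
  LinearMap.pi fun i => r ∘ₗ (x ^ (i : ℕ))

theorem jordanMap_apply (x : Module.End E V) (n : ℕ) (s : W →ₗ[E] V) (f : Fin n → W) :
    jordanMap x n s f = ∑ j : Fin n, (x ^ (n - 1 - j)) (s (f j)) := by
  simp [jordanMap, LinearMap.sum_apply]

theorem jordanComap_apply (x : Module.End E V) (n : ℕ) (r : V →ₗ[E] W) (v : V) (i : Fin n) :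
    jordanComap x n r v i = r ((x ^ (i : ℕ)) v) := rfl

theorem pow_apply_eq_zero_of_le {x : Module.End E V} {n m : ℕ} (hx : x ^ n = 0) (h : n ≤ m)
    (v : V) : (x ^ m) v = 0 := by
  rw [pow_eq_zero_of_le h hx, LinearMap.zero_apply]

/-- The composite has block entries `r x ^ (i + n - 1 - j) s`: zero for `j < i` as `x ^ n = 0`, the
identity for `j = i`. Back substitution from the last index shows injectivity. -/
theorem injective_jordanComap_comp_jordanMap {x : Module.End E V} {n : ℕ} (hx : x ^ n = 0)
    {s : W →ₗ[E] V} {r : V →ₗ[E] W} (hrs : ∀ w, r ((x ^ (n - 1)) (s w)) = w) :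
    Function.Injective (jordanComap x n r ∘ₗ jordanMap x n s) := by
  rw [injective_iff_map_eq_zero]
  intro f hf
  have key : ∀ d : ℕ, ∀ i : Fin n, n - 1 - i = d → f i = 0 := by
    intro d
    induction d using Nat.strong_induction_on with
    | _ d ih =>
      intro i hi
      have h1 := congrFun hf i
      rw [LinearMap.comp_apply, jordanComap_apply, jordanMap_apply, map_sum, map_sum,
        Finset.sum_eq_single i] at h1
      · rw [← Module.End.mul_apply, ← pow_add, show (i : ℕ) + (n - 1 - i) = n - 1 by omega,
          hrs] at h1
        exact h1
      · intro j _ hj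
        rcases lt_or_gt_of_ne hj with h | h
        · rw [← Module.End.mul_apply, ← pow_add, pow_apply_eq_zero_of_le hx, map_zero]
          have : (j : ℕ) < i := h
          omega
        · have : (i : ℕ) < j := h
          rw [ih (n - 1 - j) (by omega) j rfl, map_zero, map_zero, map_zero, map_zero]
      · simp
  exact funext fun i => key _ i rfl

/-- Since `W ^ n` is finite-dimensional, the injective composite is bijective, so the range of the
first map complements the kernel of the second. -/
theorem isCompl_range_jordanMap [FiniteDimensional E W] {x : Module.End E V} {n : ℕ}
    (hx : x ^ n = 0) {s : W →ₗ[E] V} {r : V →ₗ[E] W} (hrs : ∀ w, r ((x ^ (n - 1)) (s w)) = w) :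
    IsCompl (LinearMap.range (jordanMap x n s)) (LinearMap.ker (jordanComap x n r)) := by
  have hinj := injective_jordanComap_comp_jordanMap hx hrs
  have hsurj := LinearMap.surjective_of_injective hinj
  constructor
  · rw [Submodule.disjoint_def]
    rintro _ ⟨f, rfl⟩ hf
    have : f = 0 := hinj (by rw [map_zero]; exact hf)
    rw [this, map_zero]
  · rw [codisjoint_iff, eq_top_iff]
    intro v _
    obtain ⟨f, hf⟩ := hsurj (jordanComap x n r v)
    refine Submodule.mem_sup.2 ⟨jordanMap x n s f, ⟨f, rfl⟩, v - jordanMap x n s f, ?_,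
      add_sub_cancel _ _⟩
    rw [LinearMap.mem_ker, map_sub, ← hf, LinearMap.comp_apply, sub_self]

end JordanSplitting

/-! ### Irreducible subrepresentations -/

section Irreducible

variable {E G V : Type*} [Field E] [Group G] [AddCommGroup V] [Module E V]

theorem isIrreducible_of_isAtom {ρ : Representation E G V} {A : Subrepresentation ρ}
    (hA : IsAtom A) : A.toRepresentation.IsIrreducible := by
  let m : Subrepresentation A.toRepresentation → Subrepresentation ρ := fun C =>
    ⟨C.toSubmodule.map A.toSubmodule.subtype, by
      rintro g _ ⟨w, hw, rfl⟩
      exact ⟨A.toRepresentation g w, C.apply_mem_toSubmodule g hw, rfl⟩⟩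
  have hmA : ∀ C, m C ≤ A := by
    rintro C v ⟨w, _, hw⟩
    exact hw ▸ w.2
  have hne : ∃ v ∈ A.toSubmodule, v ≠ 0 := by
    by_contra! h
    exact hA.1 (Subrepresentation.toSubmodule_injective ((Submodule.eq_bot_iff _).2 h))
  obtain ⟨v, hv, hv0⟩ := hne
  refine { exists_pair_ne := ⟨⊥, ⊤, fun h => hv0 ?_⟩, eq_bot_or_eq_top := fun C => ?_ }
  · have h1 : (⟨v, hv⟩ : A.toSubmodule) ∈ (⊥ : Subrepresentation A.toRepresentation) :=
      h ▸ Submodule.mem_top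
    exact congrArg Subtype.val ((Submodule.mem_bot E).1 h1)
  · rcases hA.le_iff.1 (hmA C) with h | h
    · left
      refine Subrepresentation.toSubmodule_injective ?_
      refine (Submodule.eq_bot_iff _).2 fun w hw => ?_
      have h1 : (w : V) ∈ m C := ⟨w, hw, rfl⟩
      rw [h] at h1
      exact Subtype.ext ((Submodule.mem_bot E).1 h1)
    · right
      refine Subrepresentation.toSubmodule_injective ?_
      refine eq_top_iff.2 fun w _ => ?_
      have h1 : (w : V) ∈ m C := by
        rw [h]
        exact w.2
      obtain ⟨w', hw', hww⟩ := h1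
      rwa [← Subtype.ext hww]

theorem exists_le_isIrreducible [FiniteDimensional E V] {ρ : Representation E G V}
    {B : Subrepresentation ρ} (hB : B.toSubmodule ≠ ⊥) :
    ∃ A ≤ B, A.toRepresentation.IsIrreducible := by
  have hmono : StrictMono (Subrepresentation.toSubmodule : Subrepresentation ρ → Submodule E V) :=
    Monotone.strictMono_of_injective (fun _ _ h => h) Subrepresentation.toSubmodule_injective
  have : WellFoundedLT (Subrepresentation ρ) := hmono.wellFoundedLT
  have : IsAtomic (Subrepresentation ρ) := isAtomic_of_orderBot_wellFounded_lt wellFounded_lt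
  rcases eq_bot_or_exists_atom_le B with h | ⟨A, hA, hAB⟩
  · exact (hB (congrArg Subrepresentation.toSubmodule h)).elim
  · exact ⟨A, hAB, isIrreducible_of_isAtom hA⟩

theorem nontrivial_of_isIrreducible (ρ : Representation E G V) [ρ.IsIrreducible] :
    Nontrivial V := by
  by_contra h
  rw [not_nontrivial_iff_subsingleton] at h
  obtain ⟨A, B, hAB⟩ := exists_pair_ne (Subrepresentation ρ)
  exact hAB (Subrepresentation.toSubmodule_injective (Subsingleton.elim _ _))

end Irreducible

/-! ### Tensor products with Jordan blocks -/

section TensorJordan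

variable {ℓ : ℕ} [Fact ℓ.Prime] {G V W : Type*} [Group G] [AddCommGroup V]
  [Module (PadicAlgCl ℓ) V] [AddCommGroup W] [Module (PadicAlgCl ℓ) W]

/-- Computations in `W ⊗ U(n)` are carried out in `W ^ n` through this formula. -/
theorem piScalarRight_tprod (θ : Representation (PadicAlgCl ℓ) G W)
    (χ : G →* Multiplicative ℤ_[ℓ]) (n : ℕ) (g : G) (z : W ⊗[PadicAlgCl ℓ] (Fin n → PadicAlgCl ℓ))
    (i : Fin n) :
    TensorProduct.piScalarRight (PadicAlgCl ℓ) (PadicAlgCl ℓ) W (Fin n)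
      (θ.tprod ((jordanRep ℓ n).comp χ) g z) i =
    ∑ j, jordanPow ℓ n (χ g).toAdd i j • θ g
      (TensorProduct.piScalarRight (PadicAlgCl ℓ) (PadicAlgCl ℓ) W (Fin n) z j) := by
  induction z using TensorProduct.induction_on with
  | zero => simp
  | add a b ha hb =>
    simp only [map_add, Pi.add_apply, ha, hb, smul_add, Finset.sum_add_distrib]
  | tmul w c =>
    have h : ((jordanRep ℓ n).comp χ g) c = (jordanPow ℓ n (χ g).toAdd).mulVec c := rfl
    rw [Representation.tprod_apply, TensorProduct.map_tmul, h]
    simp only [TensorProduct.piScalarRight_apply, TensorProduct.piScalarRightHom_tmul,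
      Matrix.mulVec, dotProduct, map_smul, smul_smul, ← Finset.sum_smul]

theorem jordanPow_apply (n : ℕ) (a : ℤ_[ℓ]) (i j : Fin n) : jordanPow ℓ n a i j =
    if i.val ≤ j.val then padicToAlgCl ℓ (Ring.choose a (j.val - i.val)) else 0 := rfl

/-- For `i ≤ j` one has `x ^ (n - 1 - i) = x ^ (j - i) * x ^ (n - 1 - j)`, and the terms of the
series beyond `x ^ j` die against `x ^ (n - 1 - j)`. This is what makes `jordanMap` equivariant. -/
theorem sum_jordanPow_smul_pow {A : Type*} [Ring A] [Algebra (PadicAlgCl ℓ) A] {x : A} {n : ℕ}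
    (hx : x ^ n = 0) (a : ℤ_[ℓ]) (j : Fin n) :
    ∑ i : Fin n, jordanPow ℓ n a i j • x ^ (n - 1 - i) =
      binomialPow (padicToAlgCl ℓ) x n a * x ^ (n - 1 - j) := by
  have hj := j.2
  simp only [jordanPow_apply]
  rw [Fin.sum_univ_eq_sum_range (fun i : ℕ => (if i ≤ j.val then
    padicToAlgCl ℓ (Ring.choose a (j.val - i)) else 0) • x ^ (n - 1 - i)) n, binomialPow,
    Finset.sum_mul]
  have h1 : Finset.range (j.val + 1) ⊆ Finset.range n := Finset.range_subset_range.2 hj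
  rw [← Finset.sum_subset h1 (fun i _ hi => by
      rw [Finset.mem_range, not_lt] at hi
      rw [if_neg (by omega), zero_smul]),
    ← Finset.sum_subset h1 (fun i _ hi => by
      rw [Finset.mem_range, not_lt] at hi
      rw [smul_mul_assoc, ← pow_add, pow_eq_zero_of_le (by omega) hx, smul_zero]),
    ← Finset.sum_range_reflect]
  refine Finset.sum_congr rfl fun i hi => ?_
  rw [Finset.mem_range] at hi
  rw [if_pos (by omega), smul_mul_assoc, ← pow_add]
  congr 3 <;> omega

/-- Existence of the factorization: a semisimple representation twisted by a commuting unipotent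
automorphism is, when indecomposable, the tensor product of an irreducible subrepresentation
with a Jordan block. -/
theorem IsIndecomposable.exists_equiv_tprod [FiniteDimensional (PadicAlgCl ℓ) V]
    {ρ : Representation (PadicAlgCl ℓ) G V} (hind : IsIndecomposable ρ)
    {χ : G →* Multiplicative ℤ_[ℓ]} {x : Module.End (PadicAlgCl ℓ) V} (hxn : IsNilpotent x)
    (hxρ : ∀ g, Commute x (ρ g))
    (hss : ∀ (n : ℕ) (hx : x ^ n = 0) (A : Submodule (PadicAlgCl ℓ) V),
        (∀ g, ∀ v ∈ A, twist ρ χ x n hx hxρ g v ∈ A) →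
        ∃ π : Module.End (PadicAlgCl ℓ) V, (∀ g, Commute (twist ρ χ x n hx hxρ g) π) ∧
          (∀ v, π v ∈ A) ∧ ∀ v ∈ A, π v = v) :
    ∃ (A : Subrepresentation ρ) (n : ℕ), A.toRepresentation.IsIrreducible ∧ 0 < n ∧
      Nonempty (ρ.Equiv (A.toRepresentation.tprod ((jordanRep ℓ n).comp χ))) := by
  have := hind.1
  let n := nilpotencyClass x
  have hx : x ^ n = 0 := pow_nilpotencyClass hxn
  have hn : 0 < n := pos_nilpotencyClass_iff.2 hxn
  have hx1 : x ^ (n - 1) ≠ 0 := pow_pred_nilpotencyClass hxn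
  let θ := twist ρ χ x n hx hxρ
  let P := binomialPow (padicToAlgCl ℓ) x n
  have hθ : ∀ g, θ g = ρ g * P (-(χ g).toAdd) := fun g => rfl
  have hρθ : ∀ g, ρ g = θ g * P (χ g).toAdd := fun g => by
    rw [hθ, mul_assoc, ← binomialPow_add _ hx, neg_add_cancel, binomialPow_zero _ hx, mul_one]
  have hxθ : ∀ m g, Commute (x ^ m) (θ g) := fun m g =>
    ((hxρ g).mul_right (commute_binomialPow _ (Commute.refl x) n _).symm).pow_left m
  have hP : ∀ a v, x v = 0 → P a v = v := by
    intro a v hv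
    obtain ⟨m, hm⟩ : ∃ m, n = m + 1 := ⟨n - 1, by omega⟩
    simp only [P, binomialPow, hm, Finset.sum_range_succ', LinearMap.add_apply,
      LinearMap.sum_apply]
    rw [Finset.sum_eq_zero fun k _ => by
      rw [LinearMap.smul_apply, pow_succ, Module.End.mul_apply, hv, map_zero, smul_zero]]
    simp
  -- an irreducible subrepresentation of the image of `x ^ (n - 1)`
  let B : Subrepresentation ρ := ⟨LinearMap.range (x ^ (n - 1)), by
    rintro g _ ⟨v, rfl⟩
    exact ⟨ρ g v, by
      rw [← Module.End.mul_apply, ((hxρ g).pow_left _).eq, Module.End.mul_apply]⟩⟩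
  obtain ⟨A, hAB, hA⟩ := exists_le_isIrreducible (B := B) fun h => hx1 (LinearMap.range_eq_bot.1 h)
  refine ⟨A, n, hA, hn, ?_⟩
  have hxA : ∀ w ∈ A.toSubmodule, x w = 0 := by
    intro w hw
    obtain ⟨v, rfl⟩ := hAB hw
    rw [← Module.End.mul_apply, ← pow_succ', Nat.sub_add_cancel hn, hx, LinearMap.zero_apply]
  have hθA : ∀ g, ∀ w ∈ A.toSubmodule, θ g w = ρ g w := fun g w hw => by
    rw [hθ, Module.End.mul_apply, hP _ _ (hxA w hw)]
  -- the equivariant retraction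
  obtain ⟨π, hπ, hπA, hπA'⟩ := hss n hx A.toSubmodule fun g v hv => by
    change θ g v ∈ _
    rw [hθA g v hv]
    exact A.apply_mem_toSubmodule g hv
  let r : V →ₗ[PadicAlgCl ℓ] A.toSubmodule := π.codRestrict _ hπA
  have hr : ∀ g v, r (θ g v) = A.toRepresentation g (r v) := by
    intro g v
    refine Subtype.ext ?_
    change π (θ g v) = ρ g (π v)
    rw [← hθA g _ (hπA v)]
    exact (LinearMap.congr_fun (hπ g) v).symm
  -- the equivariant section
  obtain ⟨q, hq, hqK, hqK'⟩ := hss n hx (LinearMap.ker (x ^ (n - 1))) fun g v hv => by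
    change θ g v ∈ _
    rw [LinearMap.mem_ker] at hv ⊢
    rw [← Module.End.mul_apply, (hxθ _ g).eq, Module.End.mul_apply, hv, map_zero]
  obtain ⟨s₀, hs₀⟩ := (x ^ (n - 1)).rangeRestrict.exists_rightInverse_of_surjective
    (LinearMap.range_rangeRestrict _)
  -- Composing a linear section with `1 - q` puts its values in `ker q`, an invariant complement of
  -- the kernel of `x ^ (n - 1)`; this makes it equivariant.
  let s : A.toSubmodule →ₗ[PadicAlgCl ℓ] V :=
    (1 - q) ∘ₗ s₀ ∘ₗ Submodule.inclusion (show A.toSubmodule ≤ LinearMap.range (x ^ (n - 1)) from hAB)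
  have hxs : ∀ w, (x ^ (n - 1)) (s w) = w := by
    intro w
    have h1 : (x ^ (n - 1)) (s₀ (Submodule.inclusion hAB w)) = w :=
      congrArg Subtype.val (LinearMap.congr_fun hs₀ (Submodule.inclusion hAB w))
    have h2 : (x ^ (n - 1)) (q (s₀ (Submodule.inclusion hAB w))) = 0 := hqK _
    change (x ^ (n - 1)) (s₀ (Submodule.inclusion hAB w) - q (s₀ (Submodule.inclusion hAB w))) = w
    rw [map_sub, h1, h2, sub_zero]
  have hqs : ∀ w, q (s w) = 0 := by
    intro w
    change q (s₀ (Submodule.inclusion hAB w) - q (s₀ (Submodule.inclusion hAB w))) = 0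
    rw [map_sub, hqK' _ (hqK _), sub_self]
  have hs : ∀ g w, s (A.toRepresentation g w) = θ g (s w) := by
    intro g w
    rw [← sub_eq_zero, ← hqK' (s (A.toRepresentation g w) - θ g (s w))]
    · have h1 : q (θ g (s w)) = θ g (q (s w)) := (LinearMap.congr_fun (hq g) (s w)).symm
      rw [map_sub, hqs, h1, hqs, map_zero, sub_zero]
    · have h1 : (x ^ (n - 1)) (θ g (s w)) = θ g ((x ^ (n - 1)) (s w)) :=
        LinearMap.congr_fun (hxθ _ g) (s w)
      rw [LinearMap.mem_ker, map_sub, hxs, h1, hxs, hθA g _ w.2, sub_eq_zero]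
      rfl
  have hrs : ∀ w, r ((x ^ (n - 1)) (s w)) = w := fun w => by
    rw [hxs]
    exact Subtype.ext (hπA' _ w.2)
  let Φ := jordanMap x n s
  have hΦ : ∀ g f, Φ (fun i => ∑ j, jordanPow ℓ n (χ g).toAdd i j • A.toRepresentation g (f j)) =
      ρ g (Φ f) := by
    intro g f
    have h1 : ∀ (m : ℕ) w, (x ^ m) (s (A.toRepresentation g w)) = θ g ((x ^ m) (s w)) :=
      fun m w => by
        rw [hs]
        exact LinearMap.congr_fun (hxθ m g) (s w)
    have h2 := fun j => LinearMap.congr_fun (sum_jordanPow_smul_pow hx (χ g).toAdd j) (s (f j))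
    simp only [LinearMap.sum_apply, LinearMap.smul_apply, Module.End.mul_apply] at h2
    change jordanMap x n s _ = ρ g (jordanMap x n s f)
    rw [jordanMap_apply, jordanMap_apply, hρθ, Module.End.mul_apply, map_sum, map_sum]
    simp only [P, ← h2, map_sum, map_smul, h1]
    exact Finset.sum_comm
  -- Both summands are stable under `ρ`, and the range of `Φ` is nonzero because `A` is; so
  -- indecomposability makes `Φ` surjective.
  have hcompl := isCompl_range_jordanMap hx hrs
  let C : Subrepresentation ρ := ⟨LinearMap.range Φ, by
    rintro g _ ⟨f, rfl⟩
    exact ⟨_, hΦ g f⟩⟩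
  let D : Subrepresentation ρ := ⟨LinearMap.ker (jordanComap x n r), by
    intro g v hv
    have hv' : ∀ m, r ((x ^ m) v) = 0 := by
      intro m
      rcases lt_or_ge m n with h | h
      · exact congrFun hv ⟨m, h⟩
      · rw [pow_apply_eq_zero_of_le hx h, map_zero]
    rw [LinearMap.mem_ker]
    funext i
    have h1 : (x ^ (i : ℕ)) (θ g (P (χ g).toAdd v)) = θ g ((x ^ (i : ℕ)) (P (χ g).toAdd v)) :=
      LinearMap.congr_fun (hxθ i g) _
    rw [jordanComap_apply, hρθ, Module.End.mul_apply, h1, hr]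
    simp only [P, binomialPow, LinearMap.sum_apply, LinearMap.smul_apply, map_sum, map_smul]
    rw [Finset.sum_eq_zero]
    · rfl
    · intro k _
      rw [← Module.End.mul_apply, ← pow_add, hv', map_zero, smul_zero]⟩
  have hinj : Function.Injective Φ := fun a b h =>
    injective_jordanComap_comp_jordanMap hx hrs (congrArg (jordanComap x n r) h)
  have hsurj : Function.Surjective Φ := by
    rw [← LinearMap.range_eq_top]
    rcases hind.2 C D hcompl with h | h
    · exfalso
      have := nontrivial_of_isIrreducible A.toRepresentation
      obtain ⟨w, hw⟩ := exists_ne (0 : A.toSubmodule)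
      have h1 : (fun _ : Fin n => w) = 0 := hinj (by
        rw [map_zero, LinearMap.range_eq_bot.1 h, LinearMap.zero_apply])
      exact hw (congrFun h1 ⟨0, hn⟩)
    · have h1 := hcompl.sup_eq_top
      rwa [show LinearMap.ker (jordanComap x n r) = ⊥ from h, sup_bot_eq] at h1
  let e := TensorProduct.piScalarRight (PadicAlgCl ℓ) (PadicAlgCl ℓ) A.toSubmodule (Fin n)
  let F : (A.toSubmodule ⊗[PadicAlgCl ℓ] (Fin n → PadicAlgCl ℓ)) ≃ₗ[PadicAlgCl ℓ] V :=
    e ≪≫ₗ LinearEquiv.ofBijective Φ ⟨hinj, hsurj⟩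
  refine ⟨(Representation.Equiv.mk F fun g => LinearMap.ext fun z => ?_).symm⟩
  change Φ (e (A.toRepresentation.tprod ((jordanRep ℓ n).comp χ) g z)) = ρ g (Φ (e z))
  rw [← hΦ]
  exact congrArg Φ (funext fun i => piScalarRight_tprod _ χ n g z i)

end TensorJordan

/-! ### Irreducible subrepresentations of tensor products with Jordan blocks -/

section Socle

variable {ℓ : ℕ} [Fact ℓ.Prime] {G X W : Type*} [Group G] [AddCommGroup X]
  [Module (PadicAlgCl ℓ) X] [AddCommGroup W] [Module (PadicAlgCl ℓ) W]

variable {η : Representation (PadicAlgCl ℓ) G X} {θ : Representation (PadicAlgCl ℓ) G W}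
  {χ : G →* Multiplicative ℤ_[ℓ]} {n : ℕ}

/-- The coordinates of a map to `W ⊗ E ^ n`. -/
def tensorCoord (f : X →ₗ[PadicAlgCl ℓ] W ⊗[PadicAlgCl ℓ] (Fin n → PadicAlgCl ℓ)) (i : Fin n) :
    X →ₗ[PadicAlgCl ℓ] W :=
  LinearMap.proj i ∘ₗ
    (TensorProduct.piScalarRight (PadicAlgCl ℓ) (PadicAlgCl ℓ) W (Fin n)).toLinearMap ∘ₗ f

theorem tensorCoord_apply (f : X →ₗ[PadicAlgCl ℓ] W ⊗[PadicAlgCl ℓ] (Fin n → PadicAlgCl ℓ))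
    (i : Fin n) (v : X) : tensorCoord f i v =
      TensorProduct.piScalarRight (PadicAlgCl ℓ) (PadicAlgCl ℓ) W (Fin n) (f v) i := rfl

theorem eq_of_tensorCoord_eq {f : X →ₗ[PadicAlgCl ℓ] W ⊗[PadicAlgCl ℓ] (Fin n → PadicAlgCl ℓ)}
    {Y : Type*} [AddCommGroup Y] [Module (PadicAlgCl ℓ) Y]
    {f' : Y →ₗ[PadicAlgCl ℓ] W ⊗[PadicAlgCl ℓ] (Fin n → PadicAlgCl ℓ)} {v : X} {v' : Y}
    (h : ∀ i, tensorCoord f i v = tensorCoord f' i v') : f v = f' v' :=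
  (TensorProduct.piScalarRight (PadicAlgCl ℓ) (PadicAlgCl ℓ) W (Fin n)).injective (funext h)

theorem tensorCoord_map (f : η.IntertwiningMap (θ.tprod ((jordanRep ℓ n).comp χ))) (g : G) (v : X)
    (i : Fin n) : tensorCoord f.toLinearMap i (η g v) =
      ∑ j, jordanPow ℓ n (χ g).toAdd i j • θ g (tensorCoord f.toLinearMap j v) := by
  simp only [tensorCoord_apply]
  rw [← piScalarRight_tprod]
  exact congrArg (fun z => TensorProduct.piScalarRight (PadicAlgCl ℓ) (PadicAlgCl ℓ) W (Fin n) z i)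
    (Representation.IntertwiningMap.isIntertwining _ _ f g v)

/-- A nonzero map has a last nonzero coordinate; for an intertwining map it is equivariant. -/
theorem exists_last_tensorCoord (f : η.IntertwiningMap (θ.tprod ((jordanRep ℓ n).comp χ)))
    (hf : f ≠ 0) : ∃ i : Fin n, tensorCoord f.toLinearMap i ≠ 0 ∧
      (∀ j, i < j → tensorCoord f.toLinearMap j = 0) ∧
      ∀ g v, tensorCoord f.toLinearMap i (η g v) = θ g (tensorCoord f.toLinearMap i v) := by
  classical
  have hne : (Finset.univ.filter fun i => tensorCoord f.toLinearMap i ≠ 0).Nonempty := by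
    rw [Finset.filter_nonempty_iff]
    by_contra! h
    refine hf (Representation.IntertwiningMap.ext (LinearMap.ext fun v => ?_))
    refine (eq_of_tensorCoord_eq (f := f.toLinearMap) (f' := f.toLinearMap) (v' := 0)
      fun i => ?_).trans (map_zero f.toLinearMap)
    rw [h i (Finset.mem_univ i), LinearMap.zero_apply, LinearMap.zero_apply]
  obtain ⟨i, hi, hmax⟩ := Finset.exists_max_image _ id hne
  have h0 : ∀ j, i < j → tensorCoord f.toLinearMap j = 0 := by
    intro j hj
    by_contra h
    exact absurd (hmax j (Finset.mem_filter.2 ⟨Finset.mem_univ j, h⟩)) (not_le.2 hj)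
  refine ⟨i, (Finset.mem_filter.1 hi).2, h0, fun g v => ?_⟩
  -- Powers of `J` are upper triangular with ones on the diagonal, and coordinates after `i` vanish,
  -- so only `j = i` contributes.
  rw [tensorCoord_map, Finset.sum_eq_single i]
  · rw [jordanPow_apply, if_pos le_rfl, Nat.sub_self, Ring.choose_zero_right, map_one, one_smul]
  · intro j _ hj
    rcases lt_or_gt_of_ne hj with h | h
    · rw [jordanPow_apply, if_neg (by simpa using h), zero_smul]
    · rw [h0 j h, LinearMap.zero_apply, map_zero, smul_zero]
  · simp

/-- An irreducible representation mapping nontrivially to `W ⊗ U(n)`, with `W` irreducible, is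
isomorphic to `W`. -/
theorem nonempty_equiv_of_intertwiningMap_tprod [η.IsIrreducible] [θ.IsIrreducible]
    (f : η.IntertwiningMap (θ.tprod ((jordanRep ℓ n).comp χ))) (hf : f ≠ 0) :
    Nonempty (η.Equiv θ) := by
  obtain ⟨i, hi, -, hi'⟩ := exists_last_tensorCoord f hf
  let c : η.IntertwiningMap θ := ⟨tensorCoord f.toLinearMap i, fun g => LinearMap.ext (hi' g)⟩
  rcases Representation.IsIrreducible.bijective_or_eq_zero c with h | h
  · exact ⟨c.ofBijective h⟩
  · exact (hi (congrArg Representation.IntertwiningMap.toLinearMap h)).elim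

/-- An equivariant map between irreducible representations `X → W ⊗ U(n)` has its image in the
socle: only its first coordinate is nonzero. -/
theorem bijective_tensorCoord_zero [FiniteDimensional (PadicAlgCl ℓ) W] [η.IsIrreducible]
    [θ.IsIrreducible] (hχ : ∃ g, (χ g).toAdd ≠ 0)
    (f : η.IntertwiningMap (θ.tprod ((jordanRep ℓ n).comp χ))) (hf : f ≠ 0) (hn : 0 < n) :
    Function.Bijective (tensorCoord f.toLinearMap ⟨0, hn⟩) ∧
      ∀ i : Fin n, 0 < i.val → tensorCoord f.toLinearMap i = 0 := by
  obtain ⟨i, hi, hmax, hi'⟩ := exists_last_tensorCoord f hf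
  let c : η.IntertwiningMap θ := ⟨tensorCoord f.toLinearMap i, fun g => LinearMap.ext (hi' g)⟩
  have hc : Function.Bijective c :=
    (Representation.IsIrreducible.bijective_or_eq_zero c).resolve_right fun h =>
      hi (congrArg Representation.IntertwiningMap.toLinearMap h)
  rcases Nat.eq_zero_or_pos i.val with h0 | h0
  · have hi0 : i = ⟨0, hn⟩ := Fin.ext h0
    subst hi0
    exact ⟨hc, fun j hj => hmax j hj⟩
  exfalso
  obtain ⟨g, hg⟩ := hχ
  -- The coordinate just before the last nonzero one sees the superdiagonal entry of `J ^ χ(g)`,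
  -- which is `χ(g)`.
  let i₁ : Fin n := ⟨i.val - 1, by omega⟩
  have h1 : ∀ v, tensorCoord f.toLinearMap i₁ (η g v) = θ g (tensorCoord f.toLinearMap i₁ v) +
      padicToAlgCl ℓ (χ g).toAdd • θ g (c v) := by
    intro v
    have hne : i₁ ≠ i := fun h => by
      have : i.val - 1 = i.val := congrArg Fin.val h
      omega
    rw [tensorCoord_map, ← Finset.sum_subset (Finset.subset_univ {i₁, i}), Finset.sum_pair hne]
    · congr 1
      · rw [jordanPow_apply, if_pos le_rfl, Nat.sub_self, Ring.choose_zero_right, map_one, one_smul]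
      · rw [jordanPow_apply, if_pos (Nat.sub_le _ _), show i.val - i₁.val = 1 by
          change i.val - (i.val - 1) = 1; omega, Ring.choose_one_right]
        rfl
    · intro j _ hj
      simp only [Finset.mem_insert, Finset.mem_singleton, not_or] at hj
      rcases lt_or_gt_of_ne hj.1 with h | h
      · rw [jordanPow_apply, if_neg (by simpa using h), zero_smul]
      · have h2 : i.val - 1 < j.val := h
        have h3 : j.val ≠ i.val := fun h => hj.2 (Fin.ext h)
        rw [hmax j (show i.val < j.val by omega), LinearMap.zero_apply, map_zero, smul_zero]
  let e : X ≃ₗ[PadicAlgCl ℓ] W := LinearEquiv.ofBijective c.toLinearMap hc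
  let D : W →ₗ[PadicAlgCl ℓ] W := tensorCoord f.toLinearMap i₁ ∘ₗ e.symm.toLinearMap
  have hD : D * θ g = θ g * D + padicToAlgCl ℓ (χ g).toAdd • θ g := by
    refine LinearMap.ext fun w => ?_
    obtain ⟨v, rfl⟩ := e.surjective w
    have h2 : θ g (e v) = e (η g v) := (Representation.IntertwiningMap.isIntertwining _ _ c g v).symm
    change tensorCoord f.toLinearMap i₁ (e.symm (θ g (e v))) =
      θ g (tensorCoord f.toLinearMap i₁ (e.symm (e v))) + padicToAlgCl ℓ (χ g).toAdd • θ g (e v)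
    conv_lhs => rw [h2]
    rw [e.symm_apply_apply, e.symm_apply_apply, h1]
    rfl
  have hinv : θ g * θ g⁻¹ = 1 := by rw [← map_mul, mul_inv_cancel, map_one]
  have hinv' : θ g⁻¹ * θ g = 1 := by rw [← map_mul, inv_mul_cancel, map_one]
  -- Multiplying `hD` by the inverse of `θ g` and taking traces gives `tr D = tr D + χ(g) dim W`,
  -- impossible in characteristic 0.
  have htr := congrArg (fun T => LinearMap.trace (PadicAlgCl ℓ) W (θ g⁻¹ * T)) hD
  simp only [mul_add, mul_smul_comm, hinv', map_add, map_smul, ← mul_assoc, one_mul] at htr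
  rw [LinearMap.trace_mul_comm, ← mul_assoc, hinv, one_mul, left_eq_add, LinearMap.trace_one,
    smul_eq_mul, mul_eq_zero] at htr
  have := nontrivial_of_isIrreducible θ
  rcases htr with h | h
  · refine hg ?_
    rw [map_eq_zero_iff] at h
    · exact h
    · exact (algebraMap ℚ_[ℓ] (PadicAlgCl ℓ)).injective.comp Subtype.val_injective
  · exact (Module.finrank_pos (R := PadicAlgCl ℓ) (M := W)).ne' (Nat.cast_eq_zero.1 h)

/-- The inclusion of a subrepresentation. -/
def subtypeMap {ρ : Representation (PadicAlgCl ℓ) G X} (A : Subrepresentation ρ) :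
    A.toRepresentation.IntertwiningMap ρ :=
  ⟨A.toSubmodule.subtype, fun _ => rfl⟩

theorem subtypeMap_ne_zero {ρ : Representation (PadicAlgCl ℓ) G X} (A : Subrepresentation ρ)
    [A.toRepresentation.IsIrreducible] : subtypeMap A ≠ 0 := by
  intro h
  have := nontrivial_of_isIrreducible A.toRepresentation
  obtain ⟨w, hw⟩ := exists_ne (0 : A.toSubmodule)
  exact hw (Subtype.ext (LinearMap.congr_fun
    (congrArg Representation.IntertwiningMap.toLinearMap h) w))

/-- Every irreducible subrepresentation of `W ⊗ U(n)` is isomorphic to `W`. -/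
theorem nonempty_equiv_of_equiv_tprod [θ.IsIrreducible] {ρ : Representation (PadicAlgCl ℓ) G X}
    (e : ρ.Equiv (θ.tprod ((jordanRep ℓ n).comp χ))) (A : Subrepresentation ρ)
    [A.toRepresentation.IsIrreducible] : Nonempty (A.toRepresentation.Equiv θ) := by
  refine nonempty_equiv_of_intertwiningMap_tprod (n := n) (χ := χ)
    (e.toIntertwiningMap.comp (subtypeMap A)) fun h => subtypeMap_ne_zero A ?_
  refine Representation.IntertwiningMap.ext (LinearMap.ext fun v => ?_)
  have h1 : e.toLinearEquiv (subtypeMap A v) = 0 :=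
    LinearMap.congr_fun (congrArg Representation.IntertwiningMap.toLinearMap h) v
  exact e.toLinearEquiv.map_eq_zero_iff.1 h1

/-- Two nonzero summands would each contain an irreducible subrepresentation. Each of these is all
of `W ⊗ e₀`, so the summands would meet nontrivially. -/
theorem isIndecomposable_tprod [FiniteDimensional (PadicAlgCl ℓ) W] [θ.IsIrreducible]
    (hχ : ∃ g, (χ g).toAdd ≠ 0) (hn : 0 < n) :
    IsIndecomposable (θ.tprod ((jordanRep ℓ n).comp χ)) := by
  have hW := nontrivial_of_isIrreducible θ
  have : NeZero n := ⟨hn.ne'⟩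
  refine ⟨(TensorProduct.piScalarRight (PadicAlgCl ℓ) (PadicAlgCl ℓ) W
    (Fin n)).toEquiv.nontrivial, fun A B hAB => ?_⟩
  by_contra! h
  obtain ⟨A', hA, hA'⟩ := exists_le_isIrreducible h.1
  obtain ⟨B', hB, hB'⟩ := exists_le_isIrreducible h.2
  obtain ⟨hA1, hA2⟩ := bijective_tensorCoord_zero hχ (subtypeMap A') (subtypeMap_ne_zero A') hn
  obtain ⟨hB1, hB2⟩ := bijective_tensorCoord_zero hχ (subtypeMap B') (subtypeMap_ne_zero B') hn
  obtain ⟨w, hw⟩ := exists_ne (0 : W)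
  obtain ⟨a, ha⟩ := hA1.2 w
  obtain ⟨b, hb⟩ := hB1.2 w
  have hab : (a : W ⊗[PadicAlgCl ℓ] (Fin n → PadicAlgCl ℓ)) = b :=
    eq_of_tensorCoord_eq (f := (subtypeMap A').toLinearMap) (f' := (subtypeMap B').toLinearMap)
      fun i => by
        rcases Nat.eq_zero_or_pos i.val with h0 | h0
        · rw [show i = ⟨0, hn⟩ from Fin.ext h0, ha, hb]
        · rw [hA2 i h0, hB2 i h0, LinearMap.zero_apply, LinearMap.zero_apply]
  have ha0 : (a : W ⊗[PadicAlgCl ℓ] (Fin n → PadicAlgCl ℓ)) = 0 :=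
    Submodule.disjoint_def.1 hAB.disjoint _ (hA a.2) (hab ▸ hB b.2)
  have ha0' : a = 0 := Subtype.ext ha0
  rw [ha0', map_zero] at ha
  exact hw ha.symm

end Socle

theorem IsContinuousRep.toRepresentation {E G V : Type*} [Group G] [Field E] [AddCommGroup V]
    [Module E V] [TopologicalSpace G] [TopologicalSpace E] {ρ : Representation E G V}
    (hρ : IsContinuousRep ρ) (A : Subrepresentation ρ) : IsContinuousRep A.toRepresentation := by
  have := hρ.finite
  refine ⟨inferInstance, fun φ w => ?_⟩
  obtain ⟨ψ, rfl⟩ := LinearMap.exists_extend φ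
  exact hρ.2 ψ w

end InertiaRep

end

/-! ### The classification theorem -/

theorem corollary2p3
    (p ℓ : ℕ) [Fact p.Prime] [Fact ℓ.Prime] (hℓ : ℓ ≠ p)
    (k : Type*) [Field k] [IsAlgClosed k] [CharP k p]
    (Ω : Type*) [Field Ω] [Algebra k⸨X⸩ Ω] [IsSepClosure k⸨X⸩ Ω]
    (ζ : InertiaRep.tameGroup p k) (hζ : InertiaRep.IsPrimitiveSystem ζ) :
    (∀ (V : Type u) [AddCommGroup V] [Module (PadicAlgCl ℓ) V]
        (ρ : Representation (PadicAlgCl ℓ) Gal(Ω/k⸨X⸩) V),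
      InertiaRep.IsContinuousRep ρ → InertiaRep.IsIndecomposable ρ →
      ∃ (W : Type u) (_ : AddCommGroup W) (_ : Module (PadicAlgCl ℓ) W)
        (θ : Representation (PadicAlgCl ℓ) Gal(Ω/k⸨X⸩) W) (n : ℕ),
        InertiaRep.IsContinuousRep θ ∧ θ.IsIrreducible ∧ 0 < n ∧
        Nonempty (ρ.Equiv (θ.tprod (InertiaRep.inertiaU Ω hζ hℓ n))) ∧
        -- uniqueness of the factorization
        (∀ (W' : Type v) [AddCommGroup W'] [Module (PadicAlgCl ℓ) W']
            (θ' : Representation (PadicAlgCl ℓ) Gal(Ω/k⸨X⸩) W') (n' : ℕ),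
          InertiaRep.IsContinuousRep θ' → θ'.IsIrreducible → 0 < n' →
          Nonempty (ρ.Equiv (θ'.tprod (InertiaRep.inertiaU Ω hζ hℓ n'))) →
          n' = n ∧ Nonempty (θ'.Equiv θ)) ∧
        -- every irreducible subrepresentation is isomorphic to the first factor
        (∀ A : Subrepresentation ρ, A.toRepresentation.IsIrreducible →
          Nonempty (θ.Equiv A.toRepresentation))) ∧
    (∀ (W : Type v) [AddCommGroup W] [Module (PadicAlgCl ℓ) W]
        (θ : Representation (PadicAlgCl ℓ) Gal(Ω/k⸨X⸩) W) (n : ℕ),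
      InertiaRep.IsContinuousRep θ → θ.IsIrreducible → 0 < n →
      InertiaRep.IsIndecomposable (θ.tprod (InertiaRep.inertiaU Ω hζ hℓ n))) := by
  have := InertiaRep.isGalois_of_isSepClosure (k := k) (Ω := Ω)
  let χ := InertiaRep.inertiaExponent Ω hζ hℓ
  have hU : ∀ n, InertiaRep.inertiaU Ω hζ hℓ n = (InertiaRep.jordanRep ℓ n).comp χ := fun _ => rfl
  obtain ⟨σ, hσ⟩ := InertiaRep.exists_inertiaExponent_eq_one (Ω := Ω) hζ hℓ
  simp only [hU]
  refine ⟨fun V _ _ ρ hρ hind => ?_, fun W _ _ θ n hθ hirr hn => ?_⟩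
  · have := hρ.finite
    obtain ⟨N, hN⟩ := InertiaRep.exists_openNormalSubgroup_forall_eq_one hζ hℓ hρ
    obtain ⟨x, hx, hxρ, hss⟩ :=
      hind.exists_twist hρ (InertiaRep.continuous_inertiaExponent hζ hℓ) hσ N hN
    obtain ⟨A, n, hA, hn, ⟨e⟩⟩ := hind.exists_equiv_tprod hx hxρ hss
    refine ⟨A.toSubmodule, inferInstance, inferInstance, A.toRepresentation, n,
      hρ.toRepresentation A, hA, hn, ⟨e⟩, fun W' _ _ θ' n' hθ' hirr' hn' ⟨e'⟩ => ?_,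
      fun B hB => ?_⟩
    -- The irreducible `A` sits in `V ≅ W' ⊗ U(n')`, so it is isomorphic to `W'`; comparing
    -- dimensions gives `n' = n`.
    · obtain ⟨i⟩ := InertiaRep.nonempty_equiv_of_equiv_tprod e' A
      refine ⟨?_, ⟨i.symm⟩⟩
      have := hθ'.finite
      have h1 := e.toLinearEquiv.finrank_eq
      have h2 := e'.toLinearEquiv.finrank_eq
      rw [Module.finrank_tensorProduct, Module.finrank_fin_fun] at h1 h2
      rw [h1, i.toLinearEquiv.finrank_eq] at h2
      have := InertiaRep.nontrivial_of_isIrreducible θ'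
      exact (Nat.eq_of_mul_eq_mul_left (Module.finrank_pos (R := PadicAlgCl ℓ) (M := W')) h2).symm
    · obtain ⟨i⟩ := InertiaRep.nonempty_equiv_of_equiv_tprod e B
      exact ⟨i.symm⟩
  · have := hθ.finite
    exact InertiaRep.isIndecomposable_tprod ⟨σ, by rw [hσ]; exact one_ne_zero⟩ hn
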